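/- **Setting.** Let $M$ be a closed topological $3$-manifold with a (finite, simplicial) triangulation $T$, vertex set $V$, edges $E$ and directed edges $E_+$. For $\ell\in\mathbb R^{E}$, $(M,T,\ell)$ is *piecewise flat* if every simplex of $T$ is realized by a nondegenerate Euclidean simplex with edge lengths $\ell_{ij}$. Then $\gamma_{i,jk}$ denotes the angle at $i$ of the triangle $\{i,j,k\}$ and $\beta_{ij,kl}$ the dihedral angle at $\{i,j\}$ of the tetrahedron $\{i,j,k,l\}$, given by the Euclidean and spherical laws of cosines; the *edge curvature* is $$K_{ij}=\Bigl(2\pi-\sum_{k,l}\beta_{ij,kl}\Bigr)\ell_{ij}$$ (sum over the tetrahedra $\{i,j,k,l\}$ containing $\{i,j\}$), and $\mathcal{EHR}(M,T,\ell)=\sum_{\{i,j\}\in E}K_{ij}$ is the *Einstein–Hilbert–Regge functional*. A *(piecewise flat) metric* is $d\in\mathbb R^{E_+}$ such that $\ell_{ij}=d_{ij}+d_{ji}$ makes $(M,T,\ell)$ piecewise flat and $d_{ij}^2+d_{jk}^2+d_{ki}^2=d_{ji}^2+d_{ik}^2+d_{kj}^2$ for every triangle $\{i,j,k\}$. For a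 metric $d$ put $$K_i=\sum_{j}\Bigl(2\pi-\sum_{k,l}\beta_{ij,kl}\Bigr)d_{ij},\qquad h_{ij,k}=\frac{d_{ik}-d_{ij}\cos\gamma_{i,jk}}{\sin\gamma_{i,jk}},\qquad h_{ijk,l}=\frac{h_{ij,l}-h_{ij,k}\cos\beta_{ij,kl}}{\sin\beta_{ij,kl}},$$ $$\ell^*_{ij}=\sum_{k,l}\tfrac12\bigl(h_{ij,k}h_{ijk,l}+h_{ij,l}h_{ijl,k}\bigr),$$ where $j$ runs over the neighbours of $i$ and $\{i,j,k,l\}$ over the tetrahedra containing $\{i,j\}$. A *conformal structure* is a smooth map $f\mapsto d(f)$ from an open set $U\subset\mathbb R^V$ to the set of metrics such that $\partial\ell_{ij}/\partial f_i=d_{ij}$ for all $(i,j)\in E_+$, and $\partial d_{ij}/\partial f_k=0$ for $k\ne i,j$. A *conformal variation* of a metric $\bar d$ is a smooth curve $f:(-\varepsilon,\varepsilon)\to\mathbb R^V$, $\varepsilon>0$, for which there is a conformal structure (an *extension* of $f$) on some $U\supset f(-\varepsilon,\varepsilon)$ with $d(f(0))=\bar d$. **Theorem.** Let $f(t)$ be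 a conformal variation of $(M,T,\bar d)$ with an extension $f\mapsto d(f)$ on $U$. Then: 1. On $U$, for every edge, $q_{ij}:=\dfrac{\partial d_{ij}}{\partial f_j}=\dfrac{\partial d_{ji}}{\partial f_i}$. 2. $t\mapsto\mathcal{EHR}(M,T,\ell(f(t)))$ is twice differentiable on $(-\varepsilon,\varepsilon)$, and at every $t$ (in particular at $t=0$), with all geometric quantities evaluated at the metric $d(f(t))$, $$\frac{d}{dt}\mathcal{EHR}=\sum_iK_i\frac{df_i}{dt},$$ $$\frac{d^2}{dt^2}\mathcal{EHR}=\sum_i\sum_{j}\Bigl(\frac{\ell^*_{ij}}{\ell_{ij}}-\frac{q_{ij}}{2\ell_{ij}}K_{ij}\Bigr)\Bigl(\frac{df_j}{dt}-\frac{df_i}{dt}\Bigr)^2+\sum_iK_i\Bigl[\Bigl(\frac{df_i}{dt}\Bigr)^2+\frac{d^2f_i}{dt^2}\Bigr],$$ where $j$ runs over the neighbours of $i$, so that each edge is counted once in each direction. 3. $f(0)$ is a critical point of $x\mapsto\mathcal{EHR}(M,T,\ell(x))$ on $U$ if and only if $K_i(\bar d)=0$ for all $i\in V$. Likewise, the first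 variation of $\mathcal{EHR}$ at $t=0$ vanishes for all conformal variations of $\bar d$ (with any extensions) if and only if $K_i(\bar d)=0$ for all $i$. 4. If $K_i(\bar d)=0$ for all $i$, then at $t=0$ $$\frac{d^2}{dt^2}\mathcal{EHR}=\sum_i\sum_{j}\Bigl(\frac{\ell^*_{ij}}{\ell_{ij}}-\frac{q_{ij}}{2\ell_{ij}}K_{ij}\Bigr)\Bigl(\frac{df_j}{dt}-\frac{df_i}{dt}\Bigr)^2.$$ 5. $\ell(\bar d)$ is a critical point of $\mathcal{EHR}$ as a function of all edge lengths $\ell\in\mathbb R^E$ if and only if $K_{ij}=0$ for all edges (i.e. the metric is Ricci flat), and in that case, at $t=0$, $$\frac{d^2}{dt^2}\mathcal{EHR}=\sum_i\sum_{j}\frac{\ell^*_{ij}}{\ell_{ij}}\Bigl(\frac{df_j}{dt}-\frac{df_i}{dt}\Bigr)^2.$$ -/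

import Mathlib

open scoped ContDiff

noncomputable section

namespace PiecewiseFlat

/-- The geometric realization of a finite abstract simplicial complex, in barycentric
coordinates: points of the standard simplex whose support lies in a face. -/
def realization {V : Type*} [Fintype V] (T : AbstractSimplicialComplex V) : Set (V → ℝ) :=
  {x | x ∈ stdSimplex ℝ V ∧ ∃ s ∈ T.faces, ∀ i, x i ≠ 0 → i ∈ s}

/-- A triangulation of the space `M` with (finite) vertex set `V`. -/
structure Triangulation (V M : Type*) [Fintype V] [TopologicalSpace M] where
  /-- the underlying abstract simplicial complex -/
  complex : AbstractSimplicialComplex V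
  /-- the identification of its geometric realization with `M` -/
  homeo : realization complex ≃ₜ M

section Complex

variable {V : Type*} [DecidableEq V]

/-- The 1-skeleton of the complex, as a graph. -/
def skeleton (T : AbstractSimplicialComplex V) : SimpleGraph V where
  Adj i j := i ≠ j ∧ ({i, j} : Finset V) ∈ T.faces
  symm := ⟨fun i j h => ⟨h.1.symm, by rw [Finset.pair_comm]; exact h.2⟩⟩
  loopless := ⟨fun _ h => h.1 rfl⟩

instance (T : AbstractSimplicialComplex V) : DecidableRel (skeleton T).Adj :=
  Classical.decRel _

/-- The set `E(T)` of edges. -/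
abbrev Edge (T : AbstractSimplicialComplex V) := (skeleton T).edgeSet

/-- The set `E₊(T)` of directed edges `(i, j)`. -/
abbrev DirEdge (T : AbstractSimplicialComplex V) := (skeleton T).Dart

/-- `i, j, k` are the vertices of a triangle of `T`. -/
def IsTriangle (T : AbstractSimplicialComplex V) (i j k : V) : Prop :=
  i ≠ j ∧ i ≠ k ∧ j ≠ k ∧ ({i, j, k} : Finset V) ∈ T.faces

/-- `i, j, k, l` are the vertices of a tetrahedron of `T`. -/
def IsTetrahedron (T : AbstractSimplicialComplex V) (i j k l : V) : Prop :=
  i ≠ j ∧ i ≠ k ∧ i ≠ l ∧ j ≠ k ∧ j ≠ l ∧ k ≠ l ∧ ({i, j, k, l} : Finset V) ∈ T.faces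

variable {T : AbstractSimplicialComplex V}

/-- `ℓ_{ij}` (with value `0` if `{i, j}` is not an edge). -/
def edgeVal (ℓ : Edge T → ℝ) (i j : V) : ℝ :=
  if h : (skeleton T).Adj i j then ℓ ⟨s(i, j), h⟩ else 0

/-- `d_{ij}` (with value `0` if `(i, j)` is not a directed edge). -/
def dirVal (d : DirEdge T → ℝ) (i j : V) : ℝ :=
  if h : (skeleton T).Adj i j then d ⟨(i, j), h⟩ else 0

/-- `(T, ℓ)` is piecewise flat: every simplex is realized by a nondegenerate Euclidean simplex
with the prescribed edge lengths. -/
def IsPiecewiseFlat (ℓ : Edge T → ℝ) : Prop :=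
  ∀ s ∈ T.faces, ∃ (n : ℕ) (p : s → EuclideanSpace ℝ (Fin n)),
    AffineIndependent ℝ p ∧ ∀ i j : s, i ≠ j → dist (p i) (p j) = edgeVal ℓ i j

/-- The angle `γ_{i,jk}` at the vertex `i` of the triangle `{i, j, k}` (law of cosines). -/
def faceAngle (ℓ : Edge T → ℝ) (i j k : V) : ℝ :=
  Real.arccos ((edgeVal ℓ i j ^ 2 + edgeVal ℓ i k ^ 2 - edgeVal ℓ j k ^ 2) /
    (2 * edgeVal ℓ i j * edgeVal ℓ i k))

/-- The dihedral angle `β_{ij,kl}` at the edge `{i, j}` of the tetrahedron `{i, j, k, l}`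
(spherical law of cosines applied to the face angles at `i`). -/
def dihedralAngle (ℓ : Edge T → ℝ) (i j k l : V) : ℝ :=
  Real.arccos ((Real.cos (faceAngle ℓ i k l) -
      Real.cos (faceAngle ℓ i j k) * Real.cos (faceAngle ℓ i j l)) /
    (Real.sin (faceAngle ℓ i j k) * Real.sin (faceAngle ℓ i j l)))

end Complex

section Finite

variable {V : Type*} [Fintype V] [DecidableEq V] {T : AbstractSimplicialComplex V}

/-- The vertices `j` such that `{i, j}` is an edge. -/
def nbrs (T : AbstractSimplicialComplex V) (i : V) : Finset V :=
  Finset.univ.filter fun j => (skeleton T).Adj i j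

open Classical in
/-- The pairs `(k, l)` such that `{i, j, k, l}` is a tetrahedron. Every tetrahedron containing
the edge `{i, j}` is listed exactly twice, as `(k, l)` and as `(l, k)`. -/
def link (T : AbstractSimplicialComplex V) (i j : V) : Finset (V × V) :=
  Finset.univ.filter fun p => IsTetrahedron T i j p.1 p.2

/-- The angle deficit `2π - ∑_{k,l} β_{ij,kl}`, the sum being over the tetrahedra containing the
edge `{i, j}`. -/
def deficit (ℓ : Edge T → ℝ) (i j : V) : ℝ :=
  2 * Real.pi - (1 / 2) * ∑ p ∈ link T i j, dihedralAngle ℓ i j p.1 p.2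

/-- The edge curvature `K_{ij}`. -/
def edgeCurvature (ℓ : Edge T → ℝ) (i j : V) : ℝ :=
  deficit ℓ i j * edgeVal ℓ i j

/-- The Einstein-Hilbert-Regge functional, the sum of `K_{ij}` over all (undirected) edges: in
the double sum each edge occurs in both of its orientations. -/
def EHR (ℓ : Edge T → ℝ) : ℝ :=
  (1 / 2) * ∑ i, ∑ j ∈ nbrs T i, edgeCurvature ℓ i j

/-- The lengths `ℓ_{ij} = d_{ij} + d_{ji}`. -/
def length (d : DirEdge T → ℝ) (e : Edge T) : ℝ :=
  Sym2.lift ⟨fun i j => dirVal d i j + dirVal d j i, fun _ _ => add_comm _ _⟩ e.1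

/-- The space `𝔪𝔢𝔱(M, T)` of piecewise flat metrics. -/
def met (T : AbstractSimplicialComplex V) : Set (DirEdge T → ℝ) :=
  {d | IsPiecewiseFlat (length d) ∧ ∀ i j k, IsTriangle T i j k →
    dirVal d i j ^ 2 + dirVal d j k ^ 2 + dirVal d k i ^ 2 =
      dirVal d j i ^ 2 + dirVal d i k ^ 2 + dirVal d k j ^ 2}

/-- The signed distance `h_{ij,k}` from the center `c_{ij}` of the edge to the center `c_{ijk}` of
the triangle. With `u` the unit vector from `v_i` to `v_j` and `w` the unit vector orthogonal to
`u` pointing to the side of `v_k`, one has `c_{ijk} = v_i + d_{ij} u + h_{ij,k} w`, and the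
projection of `c_{ijk}` to the edge `{i, k}` is at distance `d_{ik}` from `v_i`, that is
`d_{ik} = d_{ij} cos γ_{i,jk} + h_{ij,k} sin γ_{i,jk}`. -/
def hEdge (d : DirEdge T → ℝ) (i j k : V) : ℝ :=
  (dirVal d i k - dirVal d i j * Real.cos (faceAngle (length d) i j k)) /
    Real.sin (faceAngle (length d) i j k)

/-- The signed distance `h_{ijk,l}` from the center `c_{ijk}` of the triangle to the center
`c_{ijkl}` of the tetrahedron: in the plane through `c_{ij}` orthogonal to the edge `{i, j}` one
has `h_{ij,l} = h_{ij,k} cos β_{ij,kl} + h_{ijk,l} sin β_{ij,kl}`. -/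
def hFace (d : DirEdge T → ℝ) (i j k l : V) : ℝ :=
  (hEdge d i j l - hEdge d i j k * Real.cos (dihedralAngle (length d) i j k l)) /
    Real.sin (dihedralAngle (length d) i j k l)

/-- The signed dual area `A_{ij,kl}` of the edge `{i, j}` in the tetrahedron `{i, j, k, l}`. -/
def dualArea (d : DirEdge T → ℝ) (i j k l : V) : ℝ :=
  (1 / 2) * (hEdge d i j k * hFace d i j k l + hEdge d i j l * hFace d i j l k)

/-- The dual length `ℓ*_{ij}`, the sum of `A_{ij,kl}` over the tetrahedra containing the edge
`{i, j}`. -/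
def dualLength (d : DirEdge T → ℝ) (i j : V) : ℝ :=
  (1 / 2) * ∑ p ∈ link T i j, dualArea d i j p.1 p.2

/-- The scalar curvature `K_i`. -/
def scalarCurvature (d : DirEdge T → ℝ) (i : V) : ℝ :=
  ∑ j ∈ nbrs T i, deficit (length d) i j * dirVal d i j

/-- The partial derivative `∂F/∂f_k` at `x`. -/
def partialDeriv (F : (V → ℝ) → ℝ) (k : V) (x : V → ℝ) : ℝ :=
  fderiv ℝ F x (Pi.single k 1)

/-- `C` is a conformal structure on the open set `U` of functions on the vertices. -/
structure IsConformalStructure (T : AbstractSimplicialComplex V) (U : Set (V → ℝ))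
    (C : (V → ℝ) → (DirEdge T → ℝ)) : Prop where
  isOpen : IsOpen U
  smooth : ContDiffOn ℝ ∞ C U
  mapsTo : Set.MapsTo C U (met T)
  partial_length : ∀ f ∈ U, ∀ i j, (skeleton T).Adj i j →
    partialDeriv (fun x => edgeVal (length (C x)) i j) i f = dirVal (C f) i j
  partial_dir : ∀ f ∈ U, ∀ i j, (skeleton T).Adj i j → ∀ k, k ≠ i → k ≠ j →
    partialDeriv (fun x => dirVal (C x) i j) k f = 0

/-- `f : (-ε, ε) → ℝ^V` is a conformal variation of `(M, T, d₀)` with extension `C` on `U`. -/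
structure IsConformalVariation (d₀ : DirEdge T → ℝ) (ε : ℝ) (f : ℝ → V → ℝ)
    (U : Set (V → ℝ)) (C : (V → ℝ) → (DirEdge T → ℝ)) : Prop where
  pos : 0 < ε
  smooth : ContDiffOn ℝ ∞ f (Set.Ioo (-ε) ε)
  conformal : IsConformalStructure T U C
  mapsTo : Set.MapsTo f (Set.Ioo (-ε) ε) U
  base : C (f 0) = d₀

/-- The function `t ↦ EHR(M, T, ℓ(f(t)))`. -/
def EHRalong (C : (V → ℝ) → (DirEdge T → ℝ)) (f : ℝ → V → ℝ) (t : ℝ) : ℝ :=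
  EHR (length (C (f t)))

/-- `q_{ij} = ∂d_{ij}/∂f_j` at `x`. -/
def q (C : (V → ℝ) → (DirEdge T → ℝ)) (x : V → ℝ) (i j : V) : ℝ :=
  partialDeriv (fun y => dirVal (C y) i j) j x

/-- `∑_i ∑_{j ≠ i} (ℓ*_{ij}/ℓ_{ij} - q_{ij} K_{ij}/(2 ℓ_{ij})) (df_j/dt - df_i/dt)²` at time `t`,
the inner sum being over the `j` joined to `i` by an edge. -/
def gradientTerm (C : (V → ℝ) → (DirEdge T → ℝ)) (f : ℝ → V → ℝ) (t : ℝ) : ℝ :=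
  ∑ i, ∑ j ∈ nbrs T i,
    (dualLength (C (f t)) i j / edgeVal (length (C (f t))) i j -
      q C (f t) i j / (2 * edgeVal (length (C (f t))) i j) *
        edgeCurvature (length (C (f t))) i j) *
      (deriv f t j - deriv f t i) ^ 2

end Finite

end PiecewiseFlat

end

/-! In the squared edge lengths x = ℓ² the geometry of a tetrahedron is algebraic. The cosine of the
dihedral angle at {i,j} is `tetCof` over the square roots of the two adjacent `triGram`s, and its
sine is 2 ℓ_ij √`tetGram` over the same roots. Hence dβ_ij = -`dihedralRate` / (2 ℓ_ij √`tetGram`),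
where `dihedralRate` is rational in x and linear in dx, and `tetGram` is the same for all six edges.
Schläfli's formula ∑ ℓ_ij dβ_ij = 0 thereby reduces to a rational identity, `schlaefli`. It leaves
dEHR = ∑_E (deficit) dℓ (`hasDerivAt_EHR`), and inserting dℓ_ij = d_ij df_i + d_ji df_j gives ∑ K_i
df_i.

For the second variation, K_i is differentiated and paired with df_i. The angle part rests on an
identity inside one tetrahedron: the sum over its edges {i,m} at i of d_im ∂β_im/∂f_j equals 2
A_ij/ℓ_ij, which is symmetric in i and j (`dihedralRate_vertex`, `dualArea_eq`). A constant df is a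
homothety and fixes the angles, so each df_m may be replaced by df_m - df_i. Symmetrizing in i and j
then produces the Dirichlet form (`tetSum_dihedralDeriv_mul_dirVal`). The metric part uses dd_ij =
d_ij df_i + q_ij (df_j - df_i), where q is symmetric as a mixed second derivative of ℓ_ij.
Symmetrizing gives the q-term, and ∑ K_i (df_i)² remains.

The criticality statements follow from the first variation, because every direction is realized: by
straight lines in U, or by varying a single edge length. -/

noncomputable section

namespace PiecewiseFlat

open Filter Topology

/-! ### Rational identities in the squared edge lengths of one tetrahedron. -/

section Algebra

variable {V : Type*}

/-- Twice the inner product of the edge vectors `v_j - v_i` and `v_k - v_i`, in terms of the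
squared edge lengths `x`. It is linear in `x`. -/
def polar (x : V → V → ℝ) (i j k : V) : ℝ := x i j + x i k - x j k

/-- Sixteen times the squared area of a triangle, in terms of the squared edge lengths. -/
def triGram (x : V → V → ℝ) (i j k : V) : ℝ := 4 * x i j * x i k - polar x i j k ^ 2

/-- The derivative of `triGram` at `x` in the direction `y`. -/
def triGramDeriv (x y : V → V → ℝ) (i j k : V) : ℝ :=
  4 * (y i j * x i k + x i j * y i k) - 2 * polar x i j k * polar y i j k

/-- The numerator of the cosine of the dihedral angle at the edge `{i, j}`. -/
def tetCof (x : V → V → ℝ) (i j k l : V) : ℝ :=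
  2 * x i j * polar x i k l - polar x i j k * polar x i j l

/-- The derivative of `tetCof` at `x` in the direction `y`. -/
def tetCofDeriv (x y : V → V → ℝ) (i j k l : V) : ℝ :=
  2 * (y i j * polar x i k l + x i j * polar y i k l) -
    (polar y i j k * polar x i j l + polar x i j k * polar y i j l)

/-- Four times the Gram determinant of a tetrahedron, in terms of the squared edge lengths. -/
def tetGram (x : V → V → ℝ) (i j k l : V) : ℝ :=
  4 * x i j * x i k * x i l + polar x i j k * polar x i k l * polar x i j l -
    x i j * polar x i k l ^ 2 - x i k * polar x i j l ^ 2 - x i l * polar x i j k ^ 2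

/-- The derivative of the dihedral angle at `{i, j}` in the direction `y` of squared lengths, up
to the factor `-1 / (2 ℓ_{ij} √(tetGram x))`. -/
def dihedralRate (x y : V → V → ℝ) (i j k l : V) : ℝ :=
  tetCofDeriv x y i j k l - tetCof x i j k l / 2 *
    (triGramDeriv x y i j k / triGram x i j k + triGramDeriv x y i j l / triGram x i j l)

/-- This is sin² = 1 - cos² for the dihedral angle, with denominators cleared; it brings the
symmetric quantity `tetGram` into the derivative of every angle. -/
theorem triGram_mul_sub_tetCof_sq (x : V → V → ℝ) (i j k l : V) :
    triGram x i j k * triGram x i j l - tetCof x i j k l ^ 2 = 4 * x i j * tetGram x i j k l := by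
  unfold triGram tetCof tetGram; ring

variable {x y : V → V → ℝ}

theorem triGram_swap (hx : ∀ a b, x a b = x b a) (i j k : V) : triGram x j i k = triGram x i j k := by
  simp only [triGram, polar, hx j i]; ring

theorem triGram_swap_right (hx : ∀ a b, x a b = x b a) (i j k : V) :
    triGram x i k j = triGram x i j k := by
  simp only [triGram, polar, hx k j]; ring

theorem triGramDeriv_swap (hx : ∀ a b, x a b = x b a) (hy : ∀ a b, y a b = y b a) (i j k : V) :
    triGramDeriv x y j i k = triGramDeriv x y i j k := by
  simp only [triGramDeriv, polar, hx j i, hy j i]; ring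

theorem triGramDeriv_swap_right (hx : ∀ a b, x a b = x b a) (hy : ∀ a b, y a b = y b a)
    (i j k : V) : triGramDeriv x y i k j = triGramDeriv x y i j k := by
  simp only [triGramDeriv, polar, hx k j, hy k j]; ring

theorem tetCof_swap (hx : ∀ a b, x a b = x b a) (i j k l : V) :
    tetCof x j i k l = tetCof x i j k l := by
  simp only [tetCof, polar, hx j i]; ring

theorem tetCof_swap_right (hx : ∀ a b, x a b = x b a) (i j k l : V) :
    tetCof x i j l k = tetCof x i j k l := by
  simp only [tetCof, polar, hx l k]; ring

theorem tetCofDeriv_swap_right (hx : ∀ a b, x a b = x b a) (hy : ∀ a b, y a b = y b a)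
    (i j k l : V) : tetCofDeriv x y i j l k = tetCofDeriv x y i j k l := by
  simp only [tetCofDeriv, polar, hx l k, hy l k]; ring

theorem tetGram_swap (hx : ∀ a b, x a b = x b a) (i j k l : V) :
    tetGram x j i k l = tetGram x i j k l := by
  simp only [tetGram, polar, hx j i]; ring

theorem tetGram_swap_mid (hx : ∀ a b, x a b = x b a) (i j k l : V) :
    tetGram x i k j l = tetGram x i j k l := by
  simp only [tetGram, polar, hx k j]; ring

theorem tetGram_swap_right (hx : ∀ a b, x a b = x b a) (i j k l : V) :
    tetGram x i j l k = tetGram x i j k l := by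
  simp only [tetGram, polar, hx l k]; ring

theorem dihedralRate_swap_right (hx : ∀ a b, x a b = x b a) (hy : ∀ a b, y a b = y b a)
    (i j k l : V) : dihedralRate x y i j l k = dihedralRate x y i j k l := by
  simp only [dihedralRate, tetCofDeriv_swap_right hx hy i j k l, tetCof_swap_right hx i j k l]
  ring

/-- The infinitesimal form of Schläfli's formula for a tetrahedron. -/
theorem schlaefli (hx : ∀ a b, x a b = x b a) (hy : ∀ a b, y a b = y b a) {i j k l : V}
    (h₁ : triGram x i j k ≠ 0) (h₂ : triGram x i j l ≠ 0) (h₃ : triGram x i k l ≠ 0)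
    (h₄ : triGram x j k l ≠ 0) :
    dihedralRate x y i j k l + dihedralRate x y i k j l + dihedralRate x y i l j k +
      dihedralRate x y j k i l + dihedralRate x y j l i k + dihedralRate x y k l i j = 0 := by
  -- The area of a face is the sum of the signed projections of the other three faces onto it,
  -- multiplied through by that area.
  have key : ∀ a b c d, triGram x a b c =
      tetCof x a b c d + tetCof x a c b d + tetCof x b c a d := by
    intro a b c d
    simp only [triGram, tetCof, polar, hx c b, hx b a, hx c a]; ring
  have e₁ := key i j k l
  have e₂ := key i j l k
  have e₃ := key i k l j
  have e₄ := key j k l i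
  have s₁ : triGram x j k i = triGram x i j k := by
    rw [triGram_swap_right hx, triGram_swap hx]
  have s₂ : triGram x j l i = triGram x i j l := by
    rw [triGram_swap_right hx, triGram_swap hx]
  have s₃ : triGram x k l i = triGram x i k l := by
    rw [triGram_swap_right hx, triGram_swap hx]
  have s₄ : triGram x k l j = triGram x j k l := by
    rw [triGram_swap_right hx, triGram_swap hx]
  have t₁ : triGramDeriv x y j k i = triGramDeriv x y i j k := by
    rw [triGramDeriv_swap_right hx hy, triGramDeriv_swap hx hy]
  have t₂ : triGramDeriv x y j l i = triGramDeriv x y i j l := by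
    rw [triGramDeriv_swap_right hx hy, triGramDeriv_swap hx hy]
  have t₃ : triGramDeriv x y k l i = triGramDeriv x y i k l := by
    rw [triGramDeriv_swap_right hx hy, triGramDeriv_swap hx hy]
  have t₄ : triGramDeriv x y k l j = triGramDeriv x y j k l := by
    rw [triGramDeriv_swap_right hx hy, triGramDeriv_swap hx hy]
  -- The derivative of `key` summed over the four faces; the 1/2 appears because every edge lies on
  -- two faces. By `key` itself, the logarithmic derivatives of the face areas contribute the same
  -- total, so the two parts cancel.
  have hN : tetCofDeriv x y i j k l + tetCofDeriv x y i k j l + tetCofDeriv x y i l j k +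
      tetCofDeriv x y j k i l + tetCofDeriv x y j l i k + tetCofDeriv x y k l i j =
      (triGramDeriv x y i j k + triGramDeriv x y i j l + triGramDeriv x y i k l +
        triGramDeriv x y j k l) / 2 := by
    simp only [tetCofDeriv, triGramDeriv, polar, hx j i, hx k i, hx l i, hx k j, hx l j, hx l k,
      hy j i, hy k i, hy l i, hy k j, hy l j, hy l k]
    ring
  unfold dihedralRate
  rw [triGram_swap_right hx i j k, triGram_swap_right hx i j l, triGram_swap_right hx i k l,
    triGram_swap_right hx j k l, triGramDeriv_swap_right hx hy i j k,
    triGramDeriv_swap_right hx hy i j l, triGramDeriv_swap_right hx hy i k l,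
    triGramDeriv_swap_right hx hy j k l, s₁, s₂, s₃, s₄, t₁, t₂, t₃, t₄]
  rw [tetCof_swap_right hx i j k l] at e₂
  rw [tetCof_swap_right hx i k j l, tetCof_swap_right hx i l j k] at e₃
  rw [tetCof_swap_right hx j k i l, tetCof_swap_right hx j l i k, tetCof_swap_right hx k l i j] at e₄
  have f : ∀ S D A B C : ℝ, S ≠ 0 → S = A + B + C → A * (D / S) + B * (D / S) + C * (D / S) = D := by
    intro S D A B C hS h
    rw [← add_mul, ← add_mul, ← h, mul_div_cancel₀ _ hS]
  linear_combination hN - (1 / 2) * (f _ (triGramDeriv x y i j k) _ _ _ h₁ e₁ +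
    f _ (triGramDeriv x y i j l) _ _ _ h₂ e₂ + f _ (triGramDeriv x y i k l) _ _ _ h₃ e₃ +
    f _ (triGramDeriv x y j k l) _ _ _ h₄ e₄)

/-- Dictionary: X, Y, Z are the squared lengths of the edges from i to j, k, l; c₁, c₂, c₃ are the
polars of the faces ijk, ijl, ikl; S₁, S₂ are the Gram terms of ijk and ijl; a, b, e are 2 ℓ d for
the directed edges ij, ik, il. Then 2X - a is 2 ℓ_ij d_ji, the derivative of X in f_j. -/
theorem dihedralRate_vertex_aux {X Y Z c₁ c₂ c₃ a b e S₁ S₂ : ℝ} (hX : X ≠ 0) (hY : Y ≠ 0)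
    (hZ : Z ≠ 0) (hS₁ : S₁ ≠ 0) (hS₂ : S₂ ≠ 0) (h₁ : S₁ = 4 * X * Y - c₁ ^ 2)
    (h₂ : S₂ = 4 * X * Z - c₂ ^ 2) :
    a / X * (2 * (2 * X - a) * c₃ - (c₁ - b) * c₂ - c₁ * (c₂ - e) -
        (2 * X * c₃ - c₁ * c₂) / 2 * ((4 * Y * (2 * X - a) - 2 * c₁ * (c₁ - b)) / S₁ +
          (4 * Z * (2 * X - a) - 2 * c₂ * (c₂ - e)) / S₂)) +
      b / Y * (2 * Y * (c₂ - e) - (c₁ - b) * c₃ -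
        (2 * Y * c₂ - c₁ * c₃) / 2 * ((4 * Y * (2 * X - a) - 2 * c₁ * (c₁ - b)) / S₁)) +
      e / Z * (2 * Z * (c₁ - b) - (c₂ - e) * c₃ -
        (2 * Z * c₁ - c₂ * c₃) / 2 * ((4 * Z * (2 * X - a) - 2 * c₂ * (c₂ - e)) / S₂)) =
    -(2 * (2 * X * b - a * c₁) * (2 * X * e - a * c₂) - (2 * X * c₃ - c₁ * c₂) *
      ((2 * X * b - a * c₁) ^ 2 / S₁ + (2 * X * e - a * c₂) ^ 2 / S₂)) / (2 * X ^ 2) := by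
  -- All terms over S₁ are collected: their pole cancels. Exchanging k and l gives the same for S₂,
  -- so the identity splits into two one-face identities and a remainder free of S₁ and S₂.
  have face : ∀ {Y c₁ c₂ b e S₁ : ℝ}, Y ≠ 0 → S₁ ≠ 0 → S₁ = 4 * X * Y - c₁ ^ 2 →
      b / Y * (2 * Y * (c₂ - e) - (c₁ - b) * c₃ -
        (2 * Y * c₂ - c₁ * c₃) / 2 * ((4 * Y * (2 * X - a) - 2 * c₁ * (c₁ - b)) / S₁)) -
      a / X * ((2 * X * c₃ - c₁ * c₂) / 2 * ((4 * Y * (2 * X - a) - 2 * c₁ * (c₁ - b)) / S₁)) -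
      (2 * X * c₃ - c₁ * c₂) * ((2 * X * b - a * c₁) ^ 2 / S₁) / (2 * X ^ 2) =
      2 * b * (c₂ - e) - a * (2 * X - a) * (2 * X * c₃ - c₁ * c₂) / (2 * X ^ 2) -
        (2 * X - a) * b * c₂ / X := by
    intro Y c₁ c₂ b e S₁ hY hS₁ h₁
    field_simp
    rw [h₁]
    ring
  have g₁ := face (c₂ := c₂) (b := b) (e := e) hY hS₁ h₁
  have g₂ := face (c₂ := c₁) (b := e) (e := b) hZ hS₂ h₂
  have g₃ : 2 * b * (c₂ - e) - a * (2 * X - a) * (2 * X * c₃ - c₁ * c₂) / (2 * X ^ 2) -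
        (2 * X - a) * b * c₂ / X + (2 * e * (c₁ - b) -
        a * (2 * X - a) * (2 * X * c₃ - c₂ * c₁) / (2 * X ^ 2) - (2 * X - a) * e * c₁ / X) +
      a / X * (2 * (2 * X - a) * c₃ - (c₁ - b) * c₂ - c₁ * (c₂ - e)) +
      (2 * X * b - a * c₁) * (2 * X * e - a * c₂) / X ^ 2 = 0 := by
    field_simp
    ring
  rw [← g₁, ← g₂] at g₃
  rw [← sub_eq_zero, ← g₃]
  ring

/-- `4 ℓ_{ij} A_{ijk} h_{ij,k}` up to a constant, in terms of the squared edge lengths `x` and of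
weights `w` with `2 ℓ_{ij} d_{ij} = x_{ij} + w_i - w_j`. -/
def centerNum (x : V → V → ℝ) (w : V → ℝ) (i j k : V) : ℝ :=
  2 * x i j * (x i k + w i - w k) - (x i j + w i - w j) * polar x i j k

/-- The dual area of an edge of a tetrahedron, up to the factor `16 x_{ij} ℓ_{ij} √(tetGram x)`. -/
def dualNum (x : V → V → ℝ) (w : V → ℝ) (i j k l : V) : ℝ :=
  2 * centerNum x w i j k * centerNum x w i j l - tetCof x i j k l *
    (centerNum x w i j k ^ 2 / triGram x i j k + centerNum x w i j l ^ 2 / triGram x i j l)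

theorem dualNum_swap (hx : ∀ a b, x a b = x b a) (w : V → ℝ) (i j k l : V) :
    dualNum x w j i k l = dualNum x w i j k l := by
  have h : ∀ m, centerNum x w j i m = centerNum x w i j m := by
    intro m
    simp only [centerNum, polar, hx j i]; ring
  simp only [dualNum, h, tetCof_swap hx i j, triGram_swap hx i j]

/-- The conformal derivative at `j` of the angles at the edges of a tetrahedron that contain
`i`. -/
theorem dihedralRate_vertex (hx : ∀ a b, x a b = x b a) (hy : ∀ a b, y a b = y b a)
    {w : V → ℝ} {i j k l : V} (hij : x i j ≠ 0) (hik : x i k ≠ 0) (hil : x i l ≠ 0)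
    (h₁ : triGram x i j k ≠ 0) (h₂ : triGram x i j l ≠ 0)
    (yij : y i j = x i j + w j - w i) (yjk : y j k = x j k + w j - w k)
    (yjl : y j l = x j l + w j - w l) (yik : y i k = 0) (yil : y i l = 0) (ykl : y k l = 0) :
    (x i j + w i - w j) / x i j * dihedralRate x y i j k l +
      (x i k + w i - w k) / x i k * dihedralRate x y i k j l +
      (x i l + w i - w l) / x i l * dihedralRate x y i l j k =
    -dualNum x w i j k l / (2 * x i j ^ 2) := by
  have := dihedralRate_vertex_aux (c₃ := polar x i k l) (a := x i j + w i - w j)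
    (b := x i k + w i - w k) (e := x i l + w i - w l) hij hik hil h₁ h₂ rfl rfl
  -- The face {i,k,l} does not contain j, so its area does not move.
  have n₀ : triGramDeriv x y i k l = 0 := by simp [triGramDeriv, polar, yik, yil, ykl]
  have n₁ : triGramDeriv x y i l k = 0 := by rw [triGramDeriv_swap_right hx hy, n₀]
  have y₁ : polar y i j k = polar x i j k - (x i k + w i - w k) := by
    simp only [polar, yij, yjk, yik]; ring
  have y₂ : polar y i j l = polar x i j l - (x i l + w i - w l) := by
    simp only [polar, yij, yjl, yil]; ring
  have y₃ : polar y i k l = 0 := by simp [polar, yik, yil, ykl]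
  have sw : ∀ (z : V → V → ℝ), (∀ a b, z a b = z b a) → ∀ a b c, polar z a c b = polar z a b c := by
    intro z hz a b c
    simp only [polar, hz c b]; ring
  have r₁ : dihedralRate x y i j k l = tetCofDeriv x y i j k l - tetCof x i j k l / 2 *
    (triGramDeriv x y i j k / triGram x i j k + triGramDeriv x y i j l / triGram x i j l) := rfl
  have r₂ : dihedralRate x y i k j l = tetCofDeriv x y i k j l - tetCof x i k j l / 2 *
    (triGramDeriv x y i j k / triGram x i j k) := by
    rw [dihedralRate, n₀, triGramDeriv_swap_right hx hy i j k, triGram_swap_right hx i j k]; ring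
  have r₃ : dihedralRate x y i l j k = tetCofDeriv x y i l j k - tetCof x i l j k / 2 *
    (triGramDeriv x y i j l / triGram x i j l) := by
    rw [dihedralRate, n₁, triGramDeriv_swap_right hx hy i j l, triGram_swap_right hx i j l]; ring
  rw [r₁, r₂, r₃]
  unfold dualNum centerNum tetCofDeriv tetCof triGramDeriv
  rw [sw x hx i j k, sw x hx i j l, sw x hx i k l, sw y hy i j k, sw y hy i j l,
    sw y hy i k l, y₁, y₂, y₃, yij, yik, yil]
  have e : x i j + w j - w i = 2 * x i j - (x i j + w i - w j) := by ring
  rw [e, ← this]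
  generalize x i j + w i - w j = a
  generalize x i k + w i - w k = b
  generalize x i l + w i - w l = c
  generalize triGram x i j k = S₁
  ring

end Algebra

theorem mem_faces_of_subset {V : Type*} {T : AbstractSimplicialComplex V} {s t : Finset V}
    (hs : s ∈ T.faces) (hts : t ⊆ s) (ht : t.Nonempty) : t ∈ T.faces :=
  (T.isRelLowerSet_faces hs).2 hts ht

/-! ### Nondegenerate tetrahedra: positivity of Gram determinants and formulas for the angles. -/

section Geometry

variable {V : Type*} [DecidableEq V] {T : AbstractSimplicialComplex V}

theorem edgeVal_comm (ℓ : Edge T → ℝ) (i j : V) : edgeVal ℓ i j = edgeVal ℓ j i := by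
  unfold edgeVal
  by_cases h : (skeleton T).Adj i j
  · rw [dif_pos h, dif_pos h.symm]
    congr 1
    exact Subtype.ext Sym2.eq_swap
  · rw [dif_neg h, dif_neg fun h' => h h'.symm]

namespace IsTetrahedron

variable {i j k l : V}

/-- The three adjacent transpositions in this namespace generate all relabellings of a tetrahedron;
chains of them also yield its other edges and faces. -/
theorem swap (h : IsTetrahedron T i j k l) : IsTetrahedron T j i k l := by
  obtain ⟨h₁, h₂, h₃, h₄, h₅, h₆, h₇⟩ := h
  refine ⟨h₁.symm, h₄, h₅, h₂, h₃, h₆, ?_⟩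
  rwa [Finset.insert_comm]

theorem swap_mid (h : IsTetrahedron T i j k l) : IsTetrahedron T i k j l := by
  obtain ⟨h₁, h₂, h₃, h₄, h₅, h₆, h₇⟩ := h
  refine ⟨h₂, h₁, h₃, h₄.symm, h₆, h₅, ?_⟩
  rwa [Finset.insert_comm k j]

theorem swap_right (h : IsTetrahedron T i j k l) : IsTetrahedron T i j l k := by
  obtain ⟨h₁, h₂, h₃, h₄, h₅, h₆, h₇⟩ := h
  refine ⟨h₁, h₃, h₂, h₅, h₄, h₆.symm, ?_⟩
  rwa [Finset.pair_comm l k]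

theorem adj (h : IsTetrahedron T i j k l) : (skeleton T).Adj i j := by
  obtain ⟨h₁, h₂, h₃, h₄, h₅, h₆, h₇⟩ := h
  refine ⟨h₁, mem_faces_of_subset h₇ ?_ (Finset.insert_nonempty _ _)⟩
  intro v hv
  simp only [Finset.mem_insert, Finset.mem_singleton] at hv ⊢
  tauto

end IsTetrahedron

/-- The squared edge lengths. -/
def sqLen (ℓ : Edge T → ℝ) (i j : V) : ℝ := edgeVal ℓ i j ^ 2

theorem sqLen_comm (ℓ : Edge T → ℝ) (i j : V) : sqLen ℓ i j = sqLen ℓ j i := by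
  rw [sqLen, edgeVal_comm, sqLen]

theorem IsPiecewiseFlat.edgeVal_pos {ℓ : Edge T → ℝ} (hℓ : IsPiecewiseFlat ℓ) {i j : V}
    (h : (skeleton T).Adj i j) : 0 < edgeVal ℓ i j := by
  obtain ⟨n, p, hp, hd⟩ := hℓ _ h.2
  have hne : (⟨i, by simp⟩ : ({i, j} : Finset V)) ≠ ⟨j, by simp⟩ := by
    simpa using h.1
  rw [← hd _ _ hne]
  exact dist_pos.2 (hp.injective.ne hne)

theorem triGram_pos_of_linearIndependent {E : Type*} [NormedAddCommGroup E]
    [InnerProductSpace ℝ E] {u v : E} (h : LinearIndependent ℝ ![u, v]) :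
    0 < 4 * ‖u‖ ^ 2 * ‖v‖ ^ 2 - (‖u‖ ^ 2 + ‖v‖ ^ 2 - ‖u - v‖ ^ 2) ^ 2 := by
  have hdet := (Matrix.posDef_gram_of_linearIndependent (𝕜 := ℝ) h).det_pos
  rw [Matrix.det_fin_two] at hdet
  simp only [Matrix.gram_apply, Matrix.cons_val_zero, Matrix.cons_val_one,
    real_inner_self_eq_norm_sq, real_inner_comm u v] at hdet
  rw [norm_sub_sq_real, real_inner_comm v u]
  rw [real_inner_comm v u] at hdet
  linarith

theorem tetGram_pos_of_linearIndependent {E : Type*} [NormedAddCommGroup E]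
    [InnerProductSpace ℝ E] {u v w : E} (h : LinearIndependent ℝ ![u, v, w]) :
    0 < 4 * ‖u‖ ^ 2 * ‖v‖ ^ 2 * ‖w‖ ^ 2 + (‖u‖ ^ 2 + ‖v‖ ^ 2 - ‖u - v‖ ^ 2) *
      (‖v‖ ^ 2 + ‖w‖ ^ 2 - ‖v - w‖ ^ 2) * (‖u‖ ^ 2 + ‖w‖ ^ 2 - ‖u - w‖ ^ 2) -
      ‖u‖ ^ 2 * (‖v‖ ^ 2 + ‖w‖ ^ 2 - ‖v - w‖ ^ 2) ^ 2 -
      ‖v‖ ^ 2 * (‖u‖ ^ 2 + ‖w‖ ^ 2 - ‖u - w‖ ^ 2) ^ 2 -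
      ‖w‖ ^ 2 * (‖u‖ ^ 2 + ‖v‖ ^ 2 - ‖u - v‖ ^ 2) ^ 2 := by
  have hdet := (Matrix.posDef_gram_of_linearIndependent (𝕜 := ℝ) h).det_pos
  rw [Matrix.det_fin_three] at hdet
  simp only [Matrix.gram_apply, Matrix.cons_val_zero, Matrix.cons_val_one, Matrix.cons_val,
    real_inner_self_eq_norm_sq] at hdet
  rw [real_inner_comm u v, real_inner_comm u w, real_inner_comm v w] at hdet
  simp only [norm_sub_sq_real]
  linarith

/-- Positivity of the Gram determinants of a nondegenerate tetrahedron. -/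
theorem IsPiecewiseFlat.gram_pos {ℓ : Edge T → ℝ} (hℓ : IsPiecewiseFlat ℓ) {i j k l : V}
    (h : IsTetrahedron T i j k l) :
    0 < triGram (sqLen ℓ) i j k ∧ 0 < tetGram (sqLen ℓ) i j k l := by
  obtain ⟨h₁, h₂, h₃, h₄, h₅, h₆, h₇⟩ := h
  obtain ⟨n, p, hp, hd⟩ := hℓ _ h₇
  let a : ({i, j, k, l} : Finset V) := ⟨i, by simp⟩
  let b : ({i, j, k, l} : Finset V) := ⟨j, by simp⟩
  let c : ({i, j, k, l} : Finset V) := ⟨k, by simp⟩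
  let d : ({i, j, k, l} : Finset V) := ⟨l, by simp⟩
  have hba : b ≠ a := fun h => h₁ (congrArg Subtype.val h).symm
  have hca : c ≠ a := fun h => h₂ (congrArg Subtype.val h).symm
  have hda : d ≠ a := fun h => h₃ (congrArg Subtype.val h).symm
  have hbc : b ≠ c := fun h => h₄ (congrArg Subtype.val h)
  have hbd : b ≠ d := fun h => h₅ (congrArg Subtype.val h)
  have hcd : c ≠ d := fun h => h₆ (congrArg Subtype.val h)
  have hli := (affineIndependent_iff_linearIndependent_vsub ℝ p a).1 hp
  have hinj : Function.Injective
      (![⟨b, hba⟩, ⟨c, hca⟩, ⟨d, hda⟩] : Fin 3 → {x // x ≠ a}) := by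
    intro s t hst
    fin_cases s <;> fin_cases t <;> simp_all
  have hli₃ : LinearIndependent ℝ ![p b - p a, p c - p a, p d - p a] := by
    have h := hli.comp _ hinj
    have e : (fun s : {x // x ≠ a} => p s -ᵥ p a) ∘ ![⟨b, hba⟩, ⟨c, hca⟩, ⟨d, hda⟩] =
        ![p b - p a, p c - p a, p d - p a] := by
      funext s
      fin_cases s <;> rfl
    rwa [e] at h
  have hli₂ : LinearIndependent ℝ ![p b - p a, p c - p a] := by
    convert hli₃.comp (Fin.castSucc : Fin 2 → Fin 3) (Fin.castSucc_injective _) using 1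
    funext s
    fin_cases s <;> rfl
  have e : ∀ s t, s ≠ t → ‖p s - p t‖ ^ 2 = sqLen ℓ s t := by
    intro s t hst
    rw [← dist_eq_norm, hd s t hst, sqLen]
  have g₁ := triGram_pos_of_linearIndependent hli₂
  have g₂ := tetGram_pos_of_linearIndependent hli₃
  simp only [sub_sub_sub_cancel_right] at g₁ g₂
  rw [e b c hbc, e b a hba, e c a hca, sqLen_comm ℓ b a, sqLen_comm ℓ c a] at g₁
  rw [e b c hbc, e b a hba, e c a hca, e d a hda, e b d hbd, e c d hcd, sqLen_comm ℓ b a,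
    sqLen_comm ℓ c a, sqLen_comm ℓ d a] at g₂
  exact ⟨g₁, g₂⟩

section Angles

variable {ℓ : Edge T → ℝ} {i j k l : V}

theorem cos_faceAngle (h₁ : 0 < edgeVal ℓ i j) (h₂ : 0 < edgeVal ℓ i k)
    (h₃ : 0 ≤ triGram (sqLen ℓ) i j k) :
    Real.cos (faceAngle ℓ i j k) =
      polar (sqLen ℓ) i j k / (2 * edgeVal ℓ i j * edgeVal ℓ i k) := by
  -- Nonnegativity of `triGram` is exactly the condition that the argument lies in [-1, 1], where
  -- `Real.arccos` is not truncated.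
  have h : (polar (sqLen ℓ) i j k / (2 * edgeVal ℓ i j * edgeVal ℓ i k)) ^ 2 ≤ 1 := by
    rw [div_pow, div_le_one (by positivity)]
    unfold triGram sqLen at h₃
    unfold sqLen
    linarith
  exact Real.cos_arccos (abs_le.1 ((sq_le_one_iff_abs_le_one _).1 h)).1 (abs_le.1 ((sq_le_one_iff_abs_le_one _).1 h)).2

/-- No sign of `triGram` is needed: sin(arccos c) = √(1 - c²) for every real c, and both square
roots are 0 when the triangle inequality fails. -/
theorem sin_faceAngle (h₁ : 0 < edgeVal ℓ i j) (h₂ : 0 < edgeVal ℓ i k) :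
    Real.sin (faceAngle ℓ i j k) =
      √(triGram (sqLen ℓ) i j k) / (2 * edgeVal ℓ i j * edgeVal ℓ i k) := by
  rw [faceAngle, Real.sin_arccos]
  rw [← Real.sqrt_sq (show 0 ≤ 2 * edgeVal ℓ i j * edgeVal ℓ i k by positivity),
    ← Real.sqrt_div' _ (by positivity)]
  congr 1
  rw [Real.sqrt_sq (by positivity)]
  simp only [triGram, polar, sqLen]
  field_simp
  ring

theorem dihedralAngle_eq_arccos (h₁ : 0 < edgeVal ℓ i j) (h₂ : 0 < edgeVal ℓ i k)
    (h₃ : 0 < edgeVal ℓ i l) (s₁ : 0 < triGram (sqLen ℓ) i j k)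
    (s₂ : 0 < triGram (sqLen ℓ) i j l) (s₃ : 0 < triGram (sqLen ℓ) i k l) :
    dihedralAngle ℓ i j k l = Real.arccos (tetCof (sqLen ℓ) i j k l /
      (√(triGram (sqLen ℓ) i j k) * √(triGram (sqLen ℓ) i j l))) := by
  rw [dihedralAngle, cos_faceAngle h₂ h₃ s₃.le, cos_faceAngle h₁ h₂ s₁.le,
    cos_faceAngle h₁ h₃ s₂.le, sin_faceAngle h₁ h₂, sin_faceAngle h₁ h₃]
  congr 1
  have := Real.sqrt_pos.2 s₁
  have := Real.sqrt_pos.2 s₂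
  have e : sqLen ℓ i j = edgeVal ℓ i j ^ 2 := rfl
  rw [tetCof, e]
  field_simp

/-- The sine and the cosine of the dihedral angle. -/
theorem IsPiecewiseFlat.cos_sin_dihedralAngle (hℓ : IsPiecewiseFlat ℓ)
    (h : IsTetrahedron T i j k l) :
    Real.cos (dihedralAngle ℓ i j k l) = tetCof (sqLen ℓ) i j k l /
        (√(triGram (sqLen ℓ) i j k) * √(triGram (sqLen ℓ) i j l)) ∧
      Real.sin (dihedralAngle ℓ i j k l) = 2 * edgeVal ℓ i j * √(tetGram (sqLen ℓ) i j k l) /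
        (√(triGram (sqLen ℓ) i j k) * √(triGram (sqLen ℓ) i j l)) := by
  have s₁ := (hℓ.gram_pos h).1
  have s₂ := (hℓ.gram_pos h.swap_right).1
  have s₃ := (hℓ.gram_pos h.swap_mid.swap_right).1
  have hΔ := (hℓ.gram_pos h).2
  have h₁ := hℓ.edgeVal_pos h.adj
  have hid := triGram_mul_sub_tetCof_sq (sqLen ℓ) i j k l
  have e : sqLen ℓ i j = edgeVal ℓ i j ^ 2 := rfl
  have p₁ := Real.sqrt_pos.2 s₁
  have p₂ := Real.sqrt_pos.2 s₂
  have hsq : (tetCof (sqLen ℓ) i j k l /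
      (√(triGram (sqLen ℓ) i j k) * √(triGram (sqLen ℓ) i j l))) ^ 2 ≤ 1 := by
    rw [div_pow, mul_pow, Real.sq_sqrt s₁.le, Real.sq_sqrt s₂.le, div_le_one (by positivity)]
    have : 0 ≤ 4 * sqLen ℓ i j * tetGram (sqLen ℓ) i j k l := by rw [e]; positivity
    linarith
  rw [dihedralAngle_eq_arccos h₁ (hℓ.edgeVal_pos h.swap_mid.adj)
    (hℓ.edgeVal_pos h.swap_right.swap_mid.adj) s₁ s₂ s₃]
  refine ⟨Real.cos_arccos (abs_le.1 ((sq_le_one_iff_abs_le_one _).1 hsq)).1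
    (abs_le.1 ((sq_le_one_iff_abs_le_one _).1 hsq)).2, ?_⟩
  rw [Real.sin_arccos, Real.sqrt_eq_iff_mul_self_eq (by linarith) (by positivity)]
  field_simp
  rw [Real.sq_sqrt s₁.le, Real.sq_sqrt s₂.le, Real.sq_sqrt hΔ.le, hid, e]
  ring

/-- The definition uses the face angles at i only; the symmetry becomes visible in terms of `tetCof`
and `triGram`, which do not change when i and j are exchanged. -/
theorem IsPiecewiseFlat.dihedralAngle_swap (hℓ : IsPiecewiseFlat ℓ) (h : IsTetrahedron T i j k l) :
    dihedralAngle ℓ j i k l = dihedralAngle ℓ i j k l := by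
  have eq : ∀ {i j k l : V}, IsTetrahedron T i j k l → dihedralAngle ℓ i j k l =
      Real.arccos (tetCof (sqLen ℓ) i j k l /
        (√(triGram (sqLen ℓ) i j k) * √(triGram (sqLen ℓ) i j l))) := fun h =>
    dihedralAngle_eq_arccos (hℓ.edgeVal_pos h.adj) (hℓ.edgeVal_pos h.swap_mid.adj)
      (hℓ.edgeVal_pos h.swap_right.swap_mid.adj) (hℓ.gram_pos h).1
      (hℓ.gram_pos h.swap_right).1 (hℓ.gram_pos h.swap_mid.swap_right).1
  have hx := sqLen_comm ℓ
  rw [eq h, eq h.swap, tetCof_swap hx, triGram_swap hx i j k, triGram_swap hx i j l]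

end Angles

end Geometry

/-! ### Derivatives of the dihedral angles. -/

theorem hasDerivAt_arccos_div_sqrt {N S₁ S₂ : ℝ → ℝ} {N' S₁' S₂' t : ℝ}
    (hN : HasDerivAt N N' t) (h₁ : HasDerivAt S₁ S₁' t) (h₂ : HasDerivAt S₂ S₂' t)
    (p₁ : 0 < S₁ t) (p₂ : 0 < S₂ t) (hpos : 0 < S₁ t * S₂ t - N t ^ 2) :
    HasDerivAt (fun s => Real.arccos (N s / (√(S₁ s) * √(S₂ s))))
      (-(N' - N t / 2 * (S₁' / S₁ t + S₂' / S₂ t)) / √(S₁ t * S₂ t - N t ^ 2)) t := by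
  have q₁ := Real.sqrt_pos.2 p₁
  have q₂ := Real.sqrt_pos.2 p₂
  have e₁ := Real.sq_sqrt p₁.le
  have e₂ := Real.sq_sqrt p₂.le
  have hlt : (N t / (√(S₁ t) * √(S₂ t))) ^ 2 < 1 := by
    rw [div_pow, mul_pow, e₁, e₂, div_lt_one (by positivity)]
    linarith
  have habs := abs_lt.1 ((sq_lt_one_iff_abs_lt_one _).1 hlt)
  -- The factor √S₁ √S₂ from the arccos derivative cancels the one in the quotient rule, leaving
  -- only √(S₁S₂ - N²), which becomes 2 ℓ_ij √`tetGram`.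
  have hsq : √(1 - (N t / (√(S₁ t) * √(S₂ t))) ^ 2) =
      √(S₁ t * S₂ t - N t ^ 2) / (√(S₁ t) * √(S₂ t)) := by
    rw [← Real.sqrt_mul p₁.le, ← Real.sqrt_div hpos.le, div_pow,
      Real.sq_sqrt (mul_pos p₁ p₂).le]
    congr 1
    field_simp
  have hd := (Real.hasDerivAt_arccos habs.1.ne' habs.2.ne).comp t
    (hN.div ((h₁.sqrt p₁.ne').mul (h₂.sqrt p₂.ne')) (mul_pos q₁ q₂).ne')
  refine hd.congr_deriv ?_
  simp only [Pi.mul_apply]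
  rw [hsq]
  have hr := Real.sqrt_pos.2 hpos
  generalize √(S₁ t * S₂ t - N t ^ 2) = r at *
  generalize √(S₁ t) = a at *
  generalize √(S₂ t) = b at *
  rw [← e₁, ← e₂]
  field_simp

section Derivatives

variable {V : Type*} [DecidableEq V] {T : AbstractSimplicialComplex V}

/-- The derivative of `sqLen` at `ℓ` in the direction `v`. -/
def sqLenDeriv (ℓ v : Edge T → ℝ) (i j : V) : ℝ := 2 * edgeVal ℓ i j * edgeVal v i j

theorem sqLenDeriv_comm (ℓ v : Edge T → ℝ) (i j : V) : sqLenDeriv ℓ v i j = sqLenDeriv ℓ v j i := by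
  rw [sqLenDeriv, edgeVal_comm ℓ, edgeVal_comm v, sqLenDeriv]

/-- The derivative of `dihedralAngle` at `ℓ` in the direction `v`. -/
def dihedralDeriv (ℓ v : Edge T → ℝ) (i j k l : V) : ℝ :=
  -dihedralRate (sqLen ℓ) (sqLenDeriv ℓ v) i j k l /
    (2 * edgeVal ℓ i j * √(tetGram (sqLen ℓ) i j k l))

theorem continuous_edgeVal (i j : V) : Continuous fun ℓ : Edge T → ℝ => edgeVal ℓ i j := by
  unfold edgeVal
  by_cases h : (skeleton T).Adj i j
  · simp only [dif_pos h]; fun_prop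
  · simp only [dif_neg h]; fun_prop

/-- The algebraic formula needs only strict inequalities, which persist near ℓ; openness of
piecewise flatness itself is not required. -/
theorem IsPiecewiseFlat.eventually_dihedralAngle_eq {ℓ : Edge T → ℝ} (hℓ : IsPiecewiseFlat ℓ)
    {i j k l : V} (h : IsTetrahedron T i j k l) :
    ∀ᶠ m in 𝓝 ℓ, dihedralAngle m i j k l = Real.arccos (tetCof (sqLen m) i j k l /
      (√(triGram (sqLen m) i j k) * √(triGram (sqLen m) i j l))) := by
  have c : ∀ a b, ContinuousAt (fun m : Edge T → ℝ => edgeVal m a b) ℓ := fun a b =>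
    (continuous_edgeVal a b).continuousAt
  have g : ∀ a b e, Continuous (fun m : Edge T → ℝ => triGram (sqLen m) a b e) := by
    intro a b e
    have := continuous_edgeVal (T := T) a b
    have := continuous_edgeVal (T := T) a e
    have := continuous_edgeVal (T := T) b e
    unfold triGram polar sqLen
    fun_prop
  filter_upwards [(c i j).eventually_const_lt (hℓ.edgeVal_pos h.adj),
    (c i k).eventually_const_lt (hℓ.edgeVal_pos h.swap_mid.adj),
    (c i l).eventually_const_lt (hℓ.edgeVal_pos h.swap_right.swap_mid.adj),
    (g i j k).continuousAt.eventually_const_lt (hℓ.gram_pos h).1,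
    (g i j l).continuousAt.eventually_const_lt (hℓ.gram_pos h.swap_right).1,
    (g i k l).continuousAt.eventually_const_lt (hℓ.gram_pos h.swap_mid.swap_right).1]
    with m h₁ h₂ h₃ h₄ h₅ h₆
  exact dihedralAngle_eq_arccos h₁ h₂ h₃ h₄ h₅ h₆

theorem IsPiecewiseFlat.tetCof_sq_lt {ℓ : Edge T → ℝ} (hℓ : IsPiecewiseFlat ℓ)
    {i j k l : V} (h : IsTetrahedron T i j k l) :
    0 < triGram (sqLen ℓ) i j k * triGram (sqLen ℓ) i j l - tetCof (sqLen ℓ) i j k l ^ 2 := by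
  rw [triGram_mul_sub_tetCof_sq]
  have := (hℓ.gram_pos h).2
  have : 0 < sqLen ℓ i j := pow_pos (hℓ.edgeVal_pos h.adj) 2
  positivity

theorem hasDerivAt_dihedralAngle {L : ℝ → Edge T → ℝ} {v : Edge T → ℝ} {t : ℝ}
    (hL : ∀ e, HasDerivAt (fun s => L s e) (v e) t) (hℓ : IsPiecewiseFlat (L t)) {i j k l : V}
    (h : IsTetrahedron T i j k l) :
    HasDerivAt (fun s => dihedralAngle (L s) i j k l) (dihedralDeriv (L t) v i j k l) t := by
  have hcont : ContinuousAt L t := continuousAt_pi.2 fun e => (hL e).continuousAt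
  have hE : ∀ a b, HasDerivAt (fun s => edgeVal (L s) a b) (edgeVal v a b) t := by
    intro a b
    unfold edgeVal
    by_cases hab : (skeleton T).Adj a b
    · simpa only [dif_pos hab] using hL _
    · simpa only [dif_neg hab] using hasDerivAt_const t (0 : ℝ)
  have hx : ∀ a b, HasDerivAt (fun s => sqLen (L s) a b) (sqLenDeriv (L t) v a b) t := by
    intro a b
    refine ((hE a b).pow 2).congr_deriv ?_
    simp [sqLenDeriv]
  have hp : ∀ a b c, HasDerivAt (fun s => polar (sqLen (L s)) a b c)
      (polar (sqLenDeriv (L t) v) a b c) t := fun a b c =>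
    ((hx a b).add (hx a c)).sub (hx b c)
  have hS : ∀ a b c, HasDerivAt (fun s => triGram (sqLen (L s)) a b c)
      (triGramDeriv (sqLen (L t)) (sqLenDeriv (L t) v) a b c) t := by
    intro a b c
    refine ((((hx a b).const_mul 4).mul (hx a c)).sub ((hp a b c).pow 2)).congr_deriv ?_
    simp only [triGramDeriv]
    push_cast
    ring
  have hN : HasDerivAt (fun s => tetCof (sqLen (L s)) i j k l)
      (tetCofDeriv (sqLen (L t)) (sqLenDeriv (L t) v) i j k l) t := by
    refine ((((hx i j).const_mul 2).mul (hp i k l)).sub ((hp i j k).mul (hp i j l))).congr_deriv ?_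
    simp only [tetCofDeriv]
    ring
  have key := hasDerivAt_arccos_div_sqrt hN (hS i j k) (hS i j l) (hℓ.gram_pos h).1
    (hℓ.gram_pos h.swap_right).1 (hℓ.tetCof_sq_lt h)
  refine (key.congr_of_eventuallyEq (hcont.eventually
    (hℓ.eventually_dihedralAngle_eq h))).congr_deriv ?_
  have e : √(triGram (sqLen (L t)) i j k * triGram (sqLen (L t)) i j l -
      tetCof (sqLen (L t)) i j k l ^ 2) =
      2 * edgeVal (L t) i j * √(tetGram (sqLen (L t)) i j k l) := by
    have := hℓ.edgeVal_pos h.adj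
    rw [triGram_mul_sub_tetCof_sq, Real.sqrt_mul (by unfold sqLen; positivity),
      show 4 * sqLen (L t) i j = (2 * edgeVal (L t) i j) ^ 2 by rw [sqLen]; ring,
      Real.sqrt_sq (by positivity)]
  rw [e]
  rfl

theorem hasDerivAt_edgeVal {L : ℝ → Edge T → ℝ} {v : Edge T → ℝ} {t : ℝ}
    (hL : ∀ e, HasDerivAt (fun s => L s e) (v e) t) {i j : V} (h : (skeleton T).Adj i j) :
    HasDerivAt (fun s => edgeVal (L s) i j) (edgeVal v i j) t := by
  simpa only [edgeVal, dif_pos h] using hL _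

end Derivatives

/-! ### Sums over tetrahedra, Schläfli's formula and the variation of all edge lengths. -/

section Sums

variable {V : Type*} [Fintype V] [DecidableEq V] {T : AbstractSimplicialComplex V}

/-- Derivatives along curves give the values of directional derivatives; Fréchet differentiability,
needed for critical points, is a separate matter. -/
theorem differentiableAt_dihedralAngle {ℓ : Edge T → ℝ} (hℓ : IsPiecewiseFlat ℓ) {i j k l : V}
    (h : IsTetrahedron T i j k l) :
    DifferentiableAt ℝ (fun m : Edge T → ℝ => dihedralAngle m i j k l) ℓ := by
  refine DifferentiableAt.congr_of_eventuallyEq ?_ (hℓ.eventually_dihedralAngle_eq h)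
  have hE : ∀ a b, Differentiable ℝ (fun m : Edge T → ℝ => edgeVal m a b) := by
    intro a b
    unfold edgeVal
    by_cases hab : (skeleton T).Adj a b
    · simp only [dif_pos hab]; fun_prop
    · simp only [dif_neg hab]; fun_prop
  have hp : ∀ a b c, Differentiable ℝ (fun m : Edge T → ℝ => polar (sqLen m) a b c) := by
    intro a b c
    unfold polar sqLen
    fun_prop
  have hS : ∀ a b c, Differentiable ℝ (fun m : Edge T → ℝ => triGram (sqLen m) a b c) := by
    intro a b c
    unfold triGram sqLen
    fun_prop
  have hN : Differentiable ℝ (fun m : Edge T → ℝ => tetCof (sqLen m) i j k l) := by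
    unfold tetCof sqLen
    fun_prop
  have p₁ := (hℓ.gram_pos h).1
  have p₂ := (hℓ.gram_pos h.swap_right).1
  have q₁ := Real.sqrt_pos.2 p₁
  have q₂ := Real.sqrt_pos.2 p₂
  have hlt : (tetCof (sqLen ℓ) i j k l /
      (√(triGram (sqLen ℓ) i j k) * √(triGram (sqLen ℓ) i j l))) ^ 2 < 1 := by
    rw [div_pow, mul_pow, Real.sq_sqrt p₁.le, Real.sq_sqrt p₂.le, div_lt_one (by positivity)]
    have := hℓ.tetCof_sq_lt h
    linarith
  have habs := abs_lt.1 ((sq_lt_one_iff_abs_lt_one _).1 hlt)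
  have hd := ((hS i j k).differentiableAt (x := ℓ)).sqrt p₁.ne' |>.fun_mul
    (((hS i j l).differentiableAt (x := ℓ)).sqrt p₂.ne')
  have hq : DifferentiableAt ℝ (fun m : Edge T → ℝ => tetCof (sqLen m) i j k l /
      (√(triGram (sqLen m) i j k) * √(triGram (sqLen m) i j l))) ℓ := by
    simp only [div_eq_mul_inv]
    exact hN.differentiableAt.fun_mul (hd.fun_inv (mul_pos q₁ q₂).ne')
  exact DifferentiableAt.fun_comp' ℓ
    (Real.differentiableAt_arccos.2 ⟨habs.1.ne', habs.2.ne⟩) hq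

theorem sum_nbrs_comm (F : V → V → ℝ) :
    ∑ i, ∑ j ∈ nbrs T i, F i j = ∑ i, ∑ j ∈ nbrs T i, F j i := by
  simp only [nbrs, Finset.sum_filter]
  rw [Finset.sum_comm]
  simp only [SimpleGraph.adj_comm]

theorem mem_nbrs {i j : V} : j ∈ nbrs T i ↔ (skeleton T).Adj i j := by
  simp [nbrs]

theorem mem_link {i j : V} {p : V × V} : p ∈ link T i j ↔ IsTetrahedron T i j p.1 p.2 := by
  simp [link]

theorem link_comm (i j : V) : link T j i = link T i j := by
  ext p
  simp only [mem_link]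
  exact ⟨IsTetrahedron.swap, IsTetrahedron.swap⟩

open Classical in
/-- The sum of `F i j k l` over all orderings of the vertices of all tetrahedra. -/
def tetSum (T : AbstractSimplicialComplex V) (F : V → V → V → V → ℝ) : ℝ :=
  ∑ i, ∑ j, ∑ k, ∑ l, if IsTetrahedron T i j k l then F i j k l else 0

/-- The condition on j is absorbed by the link, which is empty unless {i,j} is an edge. Sums over
ordered tetrahedra can then be relabelled freely. -/
theorem sum_nbrs_link (F : V → V → V → V → ℝ) :
    ∑ i, ∑ j ∈ nbrs T i, ∑ p ∈ link T i j, F i j p.1 p.2 = tetSum T F := by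
  refine Finset.sum_congr rfl fun i _ => ?_
  simp only [link, nbrs, Finset.sum_filter, Fintype.sum_prod_type]
  refine Finset.sum_congr rfl fun j _ => ?_
  by_cases hij : (skeleton T).Adj i j
  · rw [if_pos hij]
  · rw [if_neg hij]
    refine (Finset.sum_eq_zero fun k _ => Finset.sum_eq_zero fun l _ => if_neg fun h => ?_).symm
    exact hij h.adj

theorem tetSum_congr {F G : V → V → V → V → ℝ}
    (h : ∀ i j k l, IsTetrahedron T i j k l → F i j k l = G i j k l) : tetSum T F = tetSum T G := by
  unfold tetSum
  refine Finset.sum_congr rfl fun i _ => Finset.sum_congr rfl fun j _ =>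
    Finset.sum_congr rfl fun k _ => Finset.sum_congr rfl fun l _ => ?_
  by_cases ht : IsTetrahedron T i j k l
  · rw [if_pos ht, if_pos ht, h i j k l ht]
  · rw [if_neg ht, if_neg ht]

theorem tetSum_add (F G : V → V → V → V → ℝ) :
    tetSum T (fun i j k l => F i j k l + G i j k l) = tetSum T F + tetSum T G := by
  simp only [tetSum, ← Finset.sum_add_distrib]
  refine Finset.sum_congr rfl fun i _ => Finset.sum_congr rfl fun j _ =>
    Finset.sum_congr rfl fun k _ => Finset.sum_congr rfl fun l _ => ?_
  split_ifs <;> simp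

theorem tetSum_const_mul (c : ℝ) (F : V → V → V → V → ℝ) :
    tetSum T (fun i j k l => c * F i j k l) = c * tetSum T F := by
  simp only [tetSum, Finset.mul_sum]
  refine Finset.sum_congr rfl fun i _ => Finset.sum_congr rfl fun j _ =>
    Finset.sum_congr rfl fun k _ => Finset.sum_congr rfl fun l _ => ?_
  split_ifs <;> simp

open Classical in
theorem tetSum_swap (F : V → V → V → V → ℝ) :
    tetSum T (fun i j k l => F j i k l) = tetSum T F := by
  unfold tetSum
  rw [Finset.sum_comm]
  refine Finset.sum_congr rfl fun i _ => Finset.sum_congr rfl fun j _ =>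
    Finset.sum_congr rfl fun k _ => Finset.sum_congr rfl fun l _ => if_congr ?_ rfl rfl
  exact ⟨IsTetrahedron.swap, IsTetrahedron.swap⟩

open Classical in
theorem tetSum_swap_mid (F : V → V → V → V → ℝ) :
    tetSum T (fun i j k l => F i k j l) = tetSum T F := by
  unfold tetSum
  refine Finset.sum_congr rfl fun i _ => ?_
  rw [Finset.sum_comm]
  refine Finset.sum_congr rfl fun j _ =>
    Finset.sum_congr rfl fun k _ => Finset.sum_congr rfl fun l _ => if_congr ?_ rfl rfl
  exact ⟨IsTetrahedron.swap_mid, IsTetrahedron.swap_mid⟩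

open Classical in
theorem tetSum_swap_right (F : V → V → V → V → ℝ) :
    tetSum T (fun i j k l => F i j l k) = tetSum T F := by
  unfold tetSum
  refine Finset.sum_congr rfl fun i _ => Finset.sum_congr rfl fun j _ => ?_
  rw [Finset.sum_comm]
  refine Finset.sum_congr rfl fun k _ => Finset.sum_congr rfl fun l _ => if_congr ?_ rfl rfl
  exact ⟨IsTetrahedron.swap_right, IsTetrahedron.swap_right⟩

/-- A sum over tetrahedra vanishes if the contributions of the six edges of every tetrahedron add
up to zero. -/
theorem tetSum_eq_zero {F : V → V → V → V → ℝ} (h : ∀ i j k l, IsTetrahedron T i j k l →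
    F i j k l + F i k j l + F i l j k + F j k i l + F j l i k + F k l i j = 0) :
    tetSum T F = 0 := by
  -- By relabelling, each of the six edge terms has the same total, so the hypothesis says that six
  -- times the sum is 0.
  have e₁ := tetSum_swap_mid (T := T) F
  have e₂ := tetSum_swap_right (T := T) fun i j k l => F i k j l
  have e₃ := tetSum_swap (T := T) fun i j k l => F i k j l
  have e₄ := tetSum_swap (T := T) fun i j k l => F i l j k
  have e₅ := tetSum_swap_mid (T := T) fun i j k l => F j l i k
  have e₀ : tetSum T (fun i j k l => F i j k l + F i k j l + F i l j k + F j k i l + F j l i k +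
      F k l i j) = tetSum T fun _ _ _ _ => 0 := tetSum_congr h
  simp only [tetSum_add] at e₀
  have z : tetSum T (fun _ _ _ _ => 0) = 0 := by simp [tetSum]
  linarith

/-- Schläfli's formula, summed over all tetrahedra. -/
theorem tetSum_dihedralDeriv_mul_edgeVal {ℓ : Edge T → ℝ} (hℓ : IsPiecewiseFlat ℓ)
    (v : Edge T → ℝ) :
    tetSum T (fun i j k l => dihedralDeriv ℓ v i j k l * edgeVal ℓ i j) = 0 := by
  -- Multiplication by ℓ_ij cancels the only factor of the denominator that depends on the edge;
  -- √`tetGram` is common to the six edges.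
  have e : tetSum T (fun i j k l => dihedralDeriv ℓ v i j k l * edgeVal ℓ i j) =
      tetSum T (fun i j k l => -dihedralRate (sqLen ℓ) (sqLenDeriv ℓ v) i j k l /
        (2 * √(tetGram (sqLen ℓ) i j k l))) := by
    refine tetSum_congr fun i j k l h => ?_
    have := hℓ.edgeVal_pos h.adj
    have := Real.sqrt_pos.2 (hℓ.gram_pos h).2
    rw [dihedralDeriv]
    field_simp
  rw [e]
  refine tetSum_eq_zero fun i j k l h => ?_
  have hx := sqLen_comm ℓ
  have s₁ : tetGram (sqLen ℓ) i k j l = tetGram (sqLen ℓ) i j k l := tetGram_swap_mid hx ..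
  have s₂ : tetGram (sqLen ℓ) i l j k = tetGram (sqLen ℓ) i j k l := by
    rw [tetGram_swap_mid hx, tetGram_swap_right hx]
  have s₃ : tetGram (sqLen ℓ) j k i l = tetGram (sqLen ℓ) i j k l := by
    rw [tetGram_swap_mid hx, tetGram_swap hx]
  have s₄ : tetGram (sqLen ℓ) j l i k = tetGram (sqLen ℓ) i j k l := by
    rw [tetGram_swap_mid hx, tetGram_swap hx, tetGram_swap_right hx]
  have s₅ : tetGram (sqLen ℓ) k l i j = tetGram (sqLen ℓ) i j k l := by
    rw [tetGram_swap_mid hx, tetGram_swap hx, tetGram_swap_right hx, tetGram_swap_mid hx]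
  have key := schlaefli hx (sqLenDeriv_comm ℓ v) (hℓ.gram_pos h).1.ne'
    (hℓ.gram_pos h.swap_right).1.ne' (hℓ.gram_pos h.swap_mid.swap_right).1.ne'
    (hℓ.gram_pos h.swap.swap_mid.swap_right).1.ne'
  rw [s₁, s₂, s₃, s₄, s₅]
  linear_combination (-1 / (2 * √(tetGram (sqLen ℓ) i j k l))) * key

theorem IsPiecewiseFlat.deficit_comm {ℓ : Edge T → ℝ} (hℓ : IsPiecewiseFlat ℓ) (i j : V) :
    deficit ℓ j i = deficit ℓ i j := by
  rw [deficit, deficit, link_comm]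
  congr 2
  exact Finset.sum_congr rfl fun p hp => hℓ.dihedralAngle_swap (mem_link.1 hp)

theorem hasDerivAt_deficit {L : ℝ → Edge T → ℝ} {v : Edge T → ℝ} {t : ℝ}
    (hL : ∀ e, HasDerivAt (fun s => L s e) (v e) t) (hℓ : IsPiecewiseFlat (L t)) (i j : V) :
    HasDerivAt (fun s => deficit (L s) i j)
      (-(1 / 2) * ∑ p ∈ link T i j, dihedralDeriv (L t) v i j p.1 p.2) t := by
  have := ((HasDerivAt.fun_sum fun p (hp : p ∈ link T i j) =>
    hasDerivAt_dihedralAngle hL hℓ (mem_link.1 hp)).const_mul (1 / 2)).const_sub (2 * Real.pi)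
  refine this.congr_deriv ?_
  ring

/-- The first variation of the Einstein-Hilbert-Regge functional. -/
theorem hasDerivAt_EHR {L : ℝ → Edge T → ℝ} {v : Edge T → ℝ} {t : ℝ}
    (hL : ∀ e, HasDerivAt (fun s => L s e) (v e) t) (hℓ : IsPiecewiseFlat (L t)) :
    HasDerivAt (fun s => EHR (L s))
      ((1 / 2) * ∑ i, ∑ j ∈ nbrs T i, deficit (L t) i j * edgeVal v i j) t := by
  have := (HasDerivAt.fun_sum fun i (_ : i ∈ Finset.univ) =>
    HasDerivAt.fun_sum fun j (hj : j ∈ nbrs T i) => (hasDerivAt_deficit hL hℓ i j).mul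
      (hasDerivAt_edgeVal hL (mem_nbrs.1 hj))).const_mul (1 / 2 : ℝ)
  refine this.congr_deriv ?_
  -- Schläfli's formula removes the derivatives of the angles.
  have z := tetSum_dihedralDeriv_mul_edgeVal hℓ v
  rw [← sum_nbrs_link] at z
  simp only [Finset.sum_add_distrib, mul_assoc, Finset.sum_mul, ← Finset.mul_sum] at z ⊢
  rw [z]
  ring

theorem differentiableAt_EHR {ℓ : Edge T → ℝ} (hℓ : IsPiecewiseFlat ℓ) :
    DifferentiableAt ℝ (EHR (T := T)) ℓ := by
  unfold EHR
  refine DifferentiableAt.const_mul (DifferentiableAt.fun_sum fun i _ =>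
    DifferentiableAt.fun_sum fun j hj => DifferentiableAt.mul ?_ ?_) _
  · exact ((DifferentiableAt.fun_sum fun p hp => differentiableAt_dihedralAngle hℓ
      (mem_link.1 hp)).const_mul _).const_sub _
  · simp only [edgeVal, dif_pos (mem_nbrs.1 hj)]
    fun_prop

theorem fderiv_EHR {ℓ : Edge T → ℝ} (hℓ : IsPiecewiseFlat ℓ) (v : Edge T → ℝ) :
    fderiv ℝ (EHR (T := T)) ℓ v =
      (1 / 2) * ∑ i, ∑ j ∈ nbrs T i, deficit ℓ i j * edgeVal v i j := by
  have h₁ : HasDerivAt (fun s : ℝ => ℓ + s • v) v 0 := by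
    simpa using ((hasDerivAt_id (0 : ℝ)).smul_const v).const_add ℓ
  have h₂ := hasDerivAt_EHR (L := fun s : ℝ => ℓ + s • v) (t := 0)
    (fun e => hasDerivAt_pi.1 h₁ e) (by simpa using hℓ)
  have h₃ : HasFDerivAt (EHR (T := T)) (fderiv ℝ (EHR (T := T)) ℓ) (ℓ + (0 : ℝ) • v) := by
    simpa using (differentiableAt_EHR hℓ).hasFDerivAt
  have h₄ : HasDerivAt (fun s : ℝ => EHR (ℓ + s • v)) (fderiv ℝ (EHR (T := T)) ℓ v) 0 :=
    HasFDerivAt.comp_hasDerivAt (l := EHR (T := T)) (0 : ℝ) h₃ h₁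
  have := h₄.unique h₂
  simpa using this

/-- A nondegenerate `ℓ` is critical for the Einstein-Hilbert-Regge functional if and only if it is
Ricci flat. -/
theorem hasFDerivAt_EHR_zero_iff {ℓ : Edge T → ℝ} (hℓ : IsPiecewiseFlat ℓ) :
    HasFDerivAt (EHR (T := T)) (0 : (Edge T → ℝ) →L[ℝ] ℝ) ℓ ↔
      ∀ i j, (skeleton T).Adj i j → edgeCurvature ℓ i j = 0 := by
  constructor
  · intro h a b hab
    -- With the deficit itself as the variation of the single length {a,b}, all terms are squares or
    -- zero, so both orientations are handled by nonnegativity.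
    have e := fderiv_EHR hℓ (Pi.single ⟨s(a, b), hab⟩ (deficit ℓ a b))
    rw [h.fderiv] at e
    have hnn : ∀ i, ∀ j ∈ nbrs T i, 0 ≤ deficit ℓ i j *
        edgeVal (Pi.single ⟨s(a, b), hab⟩ (deficit ℓ a b) : Edge T → ℝ) i j := by
      intro i j hj
      rw [edgeVal, dif_pos (mem_nbrs.1 hj)]
      by_cases hs : s(i, j) = s(a, b)
      · have : (⟨s(i, j), mem_nbrs.1 hj⟩ : Edge T) = ⟨s(a, b), hab⟩ := Subtype.ext hs
        rw [this, Pi.single_eq_same]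
        rcases Sym2.eq_iff.1 hs with ⟨rfl, rfl⟩ | ⟨rfl, rfl⟩
        · exact mul_self_nonneg _
        · rw [hℓ.deficit_comm]; exact mul_self_nonneg _
      · rw [Pi.single_eq_of_ne fun h => hs (congrArg Subtype.val h), mul_zero]
    have hz : ∑ i, ∑ j ∈ nbrs T i, deficit ℓ i j *
        edgeVal (Pi.single ⟨s(a, b), hab⟩ (deficit ℓ a b) : Edge T → ℝ) i j = 0 := by
      simp only [zero_apply] at e
      linarith
    have h₁ := (Finset.sum_eq_zero_iff_of_nonneg fun i _ => Finset.sum_nonneg (hnn i)).1 hz a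
      (Finset.mem_univ _)
    have h₂ := (Finset.sum_eq_zero_iff_of_nonneg (hnn a)).1 h₁ b (mem_nbrs.2 hab)
    rw [edgeVal, dif_pos hab, Pi.single_eq_same, mul_self_eq_zero] at h₂
    rw [edgeCurvature, h₂, zero_mul]
  · intro h
    have e : fderiv ℝ (EHR (T := T)) ℓ = 0 := by
      ext v
      rw [fderiv_EHR hℓ]
      simp only [zero_apply]
      rw [Finset.sum_eq_zero fun i _ => Finset.sum_eq_zero fun j hj => ?_, mul_zero]
      have h₁ := h i j (mem_nbrs.1 hj)
      rw [edgeCurvature, mul_eq_zero, or_iff_left (hℓ.edgeVal_pos (mem_nbrs.1 hj)).ne'] at h₁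
      rw [h₁, zero_mul]
    rw [← e]
    exact (differentiableAt_EHR hℓ).hasFDerivAt

end Sums

/-! ### Conformal derivatives of the angles as a Dirichlet form. -/

section Algebra

variable {V : Type*} {x y : V → V → ℝ}

/-- Rescaling a tetrahedron does not change its dihedral angles, so that only the remaining
components of a variation of its squared edge lengths contribute. -/
theorem dihedralRate_eq_of_forall_edge {i j k l : V} (h₁ : triGram x i j k ≠ 0)
    (h₂ : triGram x i j l ≠ 0) {z₁ z₂ z₃ : V → V → ℝ} {c c₁ c₂ c₃ : ℝ}
    (h : ∀ a b, (a, b) ∈ [(i, j), (i, k), (i, l), (j, k), (j, l), (k, l)] →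
      y a b = c * x a b + c₁ * z₁ a b + c₂ * z₂ a b + c₃ * z₃ a b) :
    dihedralRate x y i j k l = c₁ * dihedralRate x z₁ i j k l + c₂ * dihedralRate x z₂ i j k l +
      c₃ * dihedralRate x z₃ i j k l := by
  have hp : ∀ a b e, (a, b) ∈ [(i, j), (i, k), (i, l), (j, k), (j, l), (k, l)] →
      (a, e) ∈ [(i, j), (i, k), (i, l), (j, k), (j, l), (k, l)] →
      (b, e) ∈ [(i, j), (i, k), (i, l), (j, k), (j, l), (k, l)] →
      polar y a b e = c * polar x a b e + c₁ * polar z₁ a b e + c₂ * polar z₂ a b e +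
        c₃ * polar z₃ a b e := by
    intro a b e ha hb he
    simp only [polar, h a b ha, h a e hb, h b e he]
    ring
  have d₁ : triGramDeriv x y i j k = 2 * c * triGram x i j k + c₁ * triGramDeriv x z₁ i j k +
      c₂ * triGramDeriv x z₂ i j k + c₃ * triGramDeriv x z₃ i j k := by
    simp only [triGramDeriv, triGram, hp i j k (by simp) (by simp) (by simp), h i j (by simp),
      h i k (by simp)]
    ring
  have d₂ : triGramDeriv x y i j l = 2 * c * triGram x i j l + c₁ * triGramDeriv x z₁ i j l +
      c₂ * triGramDeriv x z₂ i j l + c₃ * triGramDeriv x z₃ i j l := by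
    simp only [triGramDeriv, triGram, hp i j l (by simp) (by simp) (by simp), h i j (by simp),
      h i l (by simp)]
    ring
  have d₃ : tetCofDeriv x y i j k l = 2 * c * tetCof x i j k l + c₁ * tetCofDeriv x z₁ i j k l +
      c₂ * tetCofDeriv x z₂ i j k l + c₃ * tetCofDeriv x z₃ i j k l := by
    simp only [tetCofDeriv, tetCof, hp i j k (by simp) (by simp) (by simp),
      hp i j l (by simp) (by simp) (by simp), hp i k l (by simp) (by simp) (by simp),
      h i j (by simp)]
    ring
  simp only [dihedralRate, d₁, d₂, d₃]
  field_simp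
  ring

end Algebra

section Geometry

variable {V : Type*} [DecidableEq V] {T : AbstractSimplicialComplex V}

theorem edgeVal_length (d : DirEdge T → ℝ) {i j : V} (h : (skeleton T).Adj i j) :
    edgeVal (length d) i j = dirVal d i j + dirVal d j i := by
  rw [edgeVal, dif_pos h]
  rfl

variable {d : DirEdge T → ℝ} {i j k l : V}

/-- The weights of the vertices of a tetrahedron with respect to a metric. -/
theorem exists_weights (hd : d ∈ met T) (h : IsTetrahedron T i j k l) :
    ∃ w : V → ℝ, ∀ a b, a ∈ [i, j, k, l] → b ∈ [i, j, k, l] → a ≠ b →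
      sqLen (length d) a b + w a - w b = 2 * edgeVal (length d) a b * dirVal d a b := by
  have adj : ∀ a b, a ∈ [i, j, k, l] → b ∈ [i, j, k, l] → a ≠ b → (skeleton T).Adj a b := by
    intro a b ha hb hab
    refine ⟨hab, mem_faces_of_subset h.2.2.2.2.2.2 ?_ (Finset.insert_nonempty _ _)⟩
    intro v hv
    simp only [List.mem_cons, List.not_mem_nil, or_false] at ha hb
    simp only [Finset.mem_insert, Finset.mem_singleton] at hv ⊢
    rcases hv with rfl | rfl <;> assumption
  have tri : ∀ a b, a ∈ [i, j, k, l] → b ∈ [i, j, k, l] → a ≠ b → i ≠ a → i ≠ b →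
      IsTriangle T i a b := by
    intro a b ha hb hab hia hib
    refine ⟨hia, hib, hab, mem_faces_of_subset h.2.2.2.2.2.2 ?_ (Finset.insert_nonempty _ _)⟩
    intro v hv
    simp only [List.mem_cons, List.not_mem_nil, or_false] at ha hb
    simp only [Finset.mem_insert, Finset.mem_singleton] at hv ⊢
    rcases hv with rfl | rfl | rfl
    · exact Or.inl rfl
    · exact ha
    · exact hb
  -- Since ℓ_ab² - 2 ℓ_ab d_ab = d_ba² - d_ab², the weights must have these differences. The metric
  -- condition makes them a cocycle on the triangles, integrated here from i, where the weight is 0.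
  refine ⟨fun a => dirVal d a i ^ 2 - dirVal d i a ^ 2, fun a b ha hb hab => ?_⟩
  rw [sqLen, edgeVal_length d (adj a b ha hb hab)]
  by_cases hia : i = a
  · subst hia; ring
  by_cases hib : i = b
  · subst hib; ring
  have := hd.2 i a b (tri a b ha hb hab hia hib)
  linear_combination -this

theorem hEdge_eq (hd : d ∈ met T) (h : IsTetrahedron T i j k l) {w : V → ℝ}
    (hij : sqLen (length d) i j + w i - w j = 2 * edgeVal (length d) i j * dirVal d i j)
    (hik : sqLen (length d) i k + w i - w k = 2 * edgeVal (length d) i k * dirVal d i k) :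
    hEdge d i j k = centerNum (sqLen (length d)) w i j k /
      (2 * edgeVal (length d) i j * √(triGram (sqLen (length d)) i j k)) := by
  have s₁ := (hd.1.gram_pos h).1
  have h₁ := hd.1.edgeVal_pos h.adj
  have h₂ := hd.1.edgeVal_pos h.swap_mid.adj
  have := Real.sqrt_pos.2 s₁
  rw [hEdge, cos_faceAngle h₁ h₂ s₁.le, sin_faceAngle h₁ h₂, centerNum, hij, hik]
  have e : sqLen (length d) i j = edgeVal (length d) i j ^ 2 := rfl
  rw [e]
  field_simp

/-- With h = h_ij,k and h' = h_ij,l, the dual area is (2hh' - (h² + h'²) cos β) / (2 sin β);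
`dualNum` is its numerator after inserting the formulas for h, h' and β. -/
theorem dualArea_eq (hd : d ∈ met T) (h : IsTetrahedron T i j k l) {w : V → ℝ}
    (hij : sqLen (length d) i j + w i - w j = 2 * edgeVal (length d) i j * dirVal d i j)
    (hik : sqLen (length d) i k + w i - w k = 2 * edgeVal (length d) i k * dirVal d i k)
    (hil : sqLen (length d) i l + w i - w l = 2 * edgeVal (length d) i l * dirVal d i l) :
    dualArea d i j k l = dualNum (sqLen (length d)) w i j k l /
      (16 * sqLen (length d) i j * edgeVal (length d) i j *
        √(tetGram (sqLen (length d)) i j k l)) := by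
  have hx := sqLen_comm (length d)
  have s₁ := (hd.1.gram_pos h).1
  have s₂ := (hd.1.gram_pos h.swap_right).1
  have h₁ := hd.1.edgeVal_pos h.adj
  have r := Real.sqrt_pos.2 (hd.1.gram_pos h).2
  have q₁ := Real.sqrt_pos.2 s₁
  have q₂ := Real.sqrt_pos.2 s₂
  have e : sqLen (length d) i j = edgeVal (length d) i j ^ 2 := rfl
  obtain ⟨c₁, n₁⟩ := hd.1.cos_sin_dihedralAngle h
  obtain ⟨c₂, n₂⟩ := hd.1.cos_sin_dihedralAngle h.swap_right
  rw [tetCof_swap_right hx] at c₂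
  rw [tetGram_swap_right hx] at n₂
  rw [dualArea, hFace, hFace, c₁, n₁, c₂, n₂, hEdge_eq hd h hij hik,
    hEdge_eq hd h.swap_right hij hil, dualNum, e]
  have e₁ := Real.sq_sqrt s₁.le
  have e₂ := Real.sq_sqrt s₂.le
  generalize √(triGram (sqLen (length d)) i j k) = a at *
  generalize √(triGram (sqLen (length d)) i j l) = b at *
  rw [← e₁, ← e₂]
  field_simp
  ring

/-- The sum over all tetrahedra of the conformal derivatives of the dihedral angles, weighted with
the metric, is a Dirichlet form. -/
theorem tetSum_dihedralDeriv_mul_dirVal [Fintype V] (hd : d ∈ met T) (v : Edge T → ℝ) (a : V → ℝ)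
    (hv : ∀ i j, (skeleton T).Adj i j → edgeVal v i j = dirVal d i j * a i + dirVal d j i * a j) :
    tetSum T (fun i j k l => dihedralDeriv (length d) v i j k l * dirVal d i j * a i) =
      -tetSum T (fun i j k l => dualArea d i j k l / edgeVal (length d) i j * (a j - a i) ^ 2) := by
  set x := sqLen (length d) with hxdef
  have hx : ∀ a b, x a b = x b a := sqLen_comm (length d)
  -- The derivative of the squared lengths with respect to f_m.
  let Y : V → V → V → ℝ := fun m a b => 2 * edgeVal (length d) a b *
    (dirVal d a b * (if m = a then 1 else 0) + dirVal d b a * (if m = b then 1 else 0))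
  have hY : ∀ m a b, Y m a b = Y m b a := by
    intro m a b
    simp only [Y, edgeVal_comm (length d) b a]
    ring
  -- The derivative of β_ij,kl with respect to f_m, times d_ij.
  let G : V → V → V → V → V → ℝ := fun m i j k l =>
    -dihedralRate x (Y m) i j k l / (2 * edgeVal (length d) i j * √(tetGram x i j k l)) *
      dirVal d i j
  have hG : ∀ i j k l, IsTetrahedron T i j k l →
      dihedralDeriv (length d) v i j k l * dirVal d i j * a i =
        a i * (a j - a i) * G j i j k l + a i * (a k - a i) * G k i j k l +
          a i * (a l - a i) * G l i j k l := by
    intro i j k l h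
    have adj := h.adj
    have adj₂ := h.swap_mid.adj
    have adj₃ := h.swap_right.swap_mid.adj
    have adj₄ := h.swap.swap_mid.adj
    have adj₅ := h.swap.swap_right.swap_mid.adj
    have adj₆ := h.swap_mid.swap.swap_right.swap_mid.adj
    -- Subtracting the homothety with factor a_i from the variation (2 a_i on squared lengths)
    -- leaves only the differences a_m - a_i, so no derivative in f_i is needed.
    have key := dihedralRate_eq_of_forall_edge (x := x) (y := sqLenDeriv (length d) v)
      (z₁ := Y j) (z₂ := Y k) (z₃ := Y l) (c := 2 * a i) (c₁ := a j - a i) (c₂ := a k - a i)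
      (c₃ := a l - a i) (hd.1.gram_pos h).1.ne' (hd.1.gram_pos h.swap_right).1.ne' (by
        obtain ⟨n₁, n₂, n₃, n₄, n₅, n₆, -⟩ := h
        intro b c hbc
        simp only [List.mem_cons, List.not_mem_nil, or_false, Prod.mk.injEq] at hbc
        rcases hbc with ⟨rfl, rfl⟩ | ⟨rfl, rfl⟩ | ⟨rfl, rfl⟩ | ⟨rfl, rfl⟩ | ⟨rfl, rfl⟩ | ⟨rfl, rfl⟩
        all_goals
          simp only [sqLenDeriv, Y, hxdef, sqLen, hv _ _ adj, hv _ _ adj₂, hv _ _ adj₃,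
            hv _ _ adj₄, hv _ _ adj₅, hv _ _ adj₆, edgeVal_length d adj, edgeVal_length d adj₂,
            edgeVal_length d adj₃, edgeVal_length d adj₄, edgeVal_length d adj₅,
            edgeVal_length d adj₆, n₁.symm, n₂.symm, n₃.symm, n₄.symm, n₅.symm, n₆.symm,
            n₄, n₅, n₆, if_true, if_false]
          ring)
    rw [dihedralDeriv, key]
    simp only [G]
    ring
  rw [tetSum_congr hG, tetSum_add, tetSum_add]
  -- Relabelling gives all three sums the coefficient a_i (a_j - a_i), so that the derivatives in
  -- f_j of the three angles at i stand together.
  have e₁ := tetSum_swap_mid (T := T) fun i j k l => a i * (a k - a i) * G k i j k l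
  have e₂ : tetSum T (fun i j k l => a i * (a l - a i) * G l i j k l) =
      tetSum T (fun i j k l => a i * (a j - a i) * G j i l k j) := by
    rw [← tetSum_swap_right, ← tetSum_swap_mid, ← tetSum_swap_right]
  rw [← e₁, e₂, ← tetSum_add, ← tetSum_add]
  let M : V → V → V → V → ℝ := fun i j k l => dualArea d i j k l / edgeVal (length d) i j
  have hM : ∀ i j k l, IsTetrahedron T i j k l →
      G j i j k l + G j i k j l + G j i l k j = 2 * M i j k l := by
    intro i j k l h
    obtain ⟨w, hw⟩ := exists_weights hd h
    have hne := h
    obtain ⟨n₁, n₂, n₃, n₄, n₅, n₆, -⟩ := hne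
    have wij := hw i j (by simp) (by simp) n₁
    have wik := hw i k (by simp) (by simp) n₂
    have wil := hw i l (by simp) (by simp) n₃
    have p₁ := hd.1.edgeVal_pos h.adj
    have p₂ := hd.1.edgeVal_pos h.swap_mid.adj
    have p₃ := hd.1.edgeVal_pos h.swap_right.swap_mid.adj
    have key := dihedralRate_vertex (x := x) (y := Y j) (w := w) (i := i) (j := j) (k := k) (l := l)
      hx (hY j) (pow_pos p₁ 2).ne' (pow_pos p₂ 2).ne' (pow_pos p₃ 2).ne' (hd.1.gram_pos h).1.ne'
      (hd.1.gram_pos h.swap_right).1.ne'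
      (by rw [hx, hw j i (by simp) (by simp) n₁.symm, hY]; simp [Y, n₁.symm])
      (by rw [hw j k (by simp) (by simp) n₄]; simp [Y, n₄])
      (by rw [hw j l (by simp) (by simp) n₅]; simp [Y, n₅])
      (by simp [Y, n₁.symm, n₄]) (by simp [Y, n₁.symm, n₅]) (by simp [Y, n₄, n₅])
    rw [wij, wik, wil] at key
    have g₁ : tetGram x i k j l = tetGram x i j k l := tetGram_swap_mid hx ..
    have g₂ : tetGram x i l k j = tetGram x i j k l := by
      rw [tetGram_swap_right hx, tetGram_swap_mid hx, tetGram_swap_right hx]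
    have r := Real.sqrt_pos.2 (hd.1.gram_pos h).2
    simp only [G, M]
    rw [g₁, g₂, dihedralRate_swap_right hx (hY j) i l j k, dualArea_eq hd h wij wik wil]
    rw [← hxdef] at r ⊢
    have x₁ : x i j = edgeVal (length d) i j ^ 2 := rfl
    have x₂ : x i k = edgeVal (length d) i k ^ 2 := rfl
    have x₃ : x i l = edgeVal (length d) i l ^ 2 := rfl
    rw [x₁, x₂, x₃] at key
    rw [x₁]
    generalize √(tetGram x i j k l) = R at *
    have key' := congrArg (fun z => -z / (4 * R)) key
    field_simp at key' ⊢
    linear_combination 4 * key'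
  have hMs : ∀ i j k l, IsTetrahedron T i j k l → M j i k l = M i j k l := by
    intro i j k l h
    obtain ⟨w, hw⟩ := exists_weights hd h
    obtain ⟨n₁, n₂, n₃, n₄, n₅, n₆, -⟩ := id h
    simp only [M]
    rw [dualArea_eq hd h (hw i j (by simp) (by simp) n₁) (hw i k (by simp) (by simp) n₂)
      (hw i l (by simp) (by simp) n₃), dualArea_eq hd h.swap
      (hw j i (by simp) (by simp) n₁.symm) (hw j k (by simp) (by simp) n₄)
      (hw j l (by simp) (by simp) n₅), dualNum_swap (sqLen_comm (length d)),
      sqLen_comm (length d) j i, edgeVal_comm (length d) j i,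
      tetGram_swap (sqLen_comm (length d))]
  have f₁ : tetSum T (fun i j k l => a i * (a j - a i) * G j i j k l +
      a i * (a j - a i) * G j i k j l + a i * (a j - a i) * G j i l k j) =
      tetSum T (fun i j k l => 2 * (a i * (a j - a i) * M i j k l)) :=
    tetSum_congr fun i j k l h => by linear_combination (a i * (a j - a i)) * hM i j k l h
  have f₂ := tetSum_swap (T := T) fun i j k l => a i * (a j - a i) * M i j k l
  -- As M is symmetric in i and j, averaging a_i (a_j - a_i) with its swap gives -(a_j - a_i)²/2.
  have f₃ : tetSum T (fun i j k l => a j * (a i - a j) * M j i k l + a i * (a j - a i) * M i j k l) =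
      tetSum T (fun i j k l => (-1) * (M i j k l * (a j - a i) ^ 2)) :=
    tetSum_congr fun i j k l h => by rw [hMs i j k l h]; ring
  rw [tetSum_add, tetSum_const_mul] at f₃
  rw [f₁, tetSum_const_mul]
  linarith

end Geometry

/-! ### Calculus on a conformal structure. -/

section Conformal

variable {V : Type*} [DecidableEq V] {T : AbstractSimplicialComplex V}

theorem hasDerivAt_dirVal {D : ℝ → DirEdge T → ℝ} {D' : DirEdge T → ℝ} {t : ℝ}
    (hD : HasDerivAt D D' t) (i j : V) :
    HasDerivAt (fun s => dirVal (D s) i j) (dirVal D' i j) t := by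
  unfold dirVal
  by_cases h : (skeleton T).Adj i j
  · simpa only [dif_pos h] using hasDerivAt_pi.1 hD _
  · simpa only [dif_neg h] using hasDerivAt_const t (0 : ℝ)

theorem hasDerivAt_length {D : ℝ → DirEdge T → ℝ} {D' : DirEdge T → ℝ} {t : ℝ}
    (hD : HasDerivAt D D' t) (e : Edge T) :
    HasDerivAt (fun s => length (D s) e) (length D' e) t := by
  obtain ⟨e, he⟩ := e
  induction e with
  | h i j => exact (hasDerivAt_dirVal hD i j).add (hasDerivAt_dirVal hD j i)

variable [Fintype V]

theorem contDiff_dirVal (i j : V) : ContDiff ℝ ∞ fun d : DirEdge T → ℝ => dirVal d i j := by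
  unfold dirVal
  by_cases h : (skeleton T).Adj i j
  · simp only [dif_pos h]; fun_prop
  · simp only [dif_neg h]; fun_prop

theorem differentiable_length : Differentiable ℝ (length (T := T)) := by
  refine differentiable_pi.2 fun e => ?_
  obtain ⟨e, he⟩ := e
  induction e with
  | h i j =>
    exact ((contDiff_dirVal i j).differentiable (by simp)).add
      ((contDiff_dirVal j i).differentiable (by simp))

theorem fderiv_apply_eq_sum_partialDeriv (F : (V → ℝ) → ℝ) (x a : V → ℝ) :
    fderiv ℝ F x a = ∑ k, a k * partialDeriv F k x := by
  conv_lhs => rw [pi_eq_sum_univ' a, map_sum]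
  refine Finset.sum_congr rfl fun k _ => ?_
  rw [map_smul, smul_eq_mul, partialDeriv]

namespace IsConformalStructure

variable {U : Set (V → ℝ)} {C : (V → ℝ) → (DirEdge T → ℝ)} {x : V → ℝ}

theorem contDiffAt (hC : IsConformalStructure T U C) (hx : x ∈ U) : ContDiffAt ℝ ∞ C x :=
  hC.smooth.contDiffAt (hC.isOpen.mem_nhds hx)

theorem differentiableAt (hC : IsConformalStructure T U C) (hx : x ∈ U) :
    DifferentiableAt ℝ C x :=
  (hC.contDiffAt hx).differentiableAt (by simp)

theorem contDiffAt_dirVal (hC : IsConformalStructure T U C) (hx : x ∈ U) (i j : V) :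
    ContDiffAt ℝ ∞ (fun y => dirVal (C y) i j) x :=
  (contDiff_dirVal i j).contDiffAt.comp x (hC.contDiffAt hx)

theorem partialDeriv_add (hC : IsConformalStructure T U C) {i j : V}
    (h : (skeleton T).Adj i j) (hx : x ∈ U) :
    partialDeriv (fun y => dirVal (C y) i j) i x + partialDeriv (fun y => dirVal (C y) j i) i x =
      dirVal (C x) i j := by
  rw [← hC.partial_length x hx i j h]
  simp only [edgeVal_length _ h, partialDeriv]
  rw [fderiv_fun_add ((hC.contDiffAt_dirVal hx i j).differentiableAt (by simp))
    ((hC.contDiffAt_dirVal hx j i).differentiableAt (by simp))]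
  rfl

/-- The symmetry of `q`, from the symmetry of the second derivative of the edge length. -/
theorem q_comm (hC : IsConformalStructure T U C) {i j : V} (h : (skeleton T).Adj i j)
    (hx : x ∈ U) : q C x i j = q C x j i := by
  set E : (V → ℝ) → ℝ := fun y => edgeVal (length (C y)) i j with hE
  have hsm : ContDiffAt ℝ (2 : ℕ) E x := by
    refine contDiffAt_infty.1 ?_ 2
    simp only [hE, edgeVal_length _ h]
    exact (hC.contDiffAt_dirVal hx i j).add (hC.contDiffAt_dirVal hx j i)
  have hsymm : IsSymmSndFDerivAt ℝ E x := hsm.isSymmSndFDerivAt (by simp)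
  have hd : DifferentiableAt ℝ (fderiv ℝ E) x :=
    (hsm.fderiv_right (m := 1) (by norm_num)).differentiableAt (by simp)
  -- The defining equation for ∂ℓ_ij/∂f_i holds on the open set U, so it may be differentiated once
  -- more.
  have h₁ : (fun y => dirVal (C y) i j) =ᶠ[𝓝 x] fun y => fderiv ℝ E y (Pi.single i 1) := by
    filter_upwards [hC.isOpen.mem_nhds hx] with y hy
    exact (hC.partial_length y hy i j h).symm
  have h₂ : (fun y => dirVal (C y) j i) =ᶠ[𝓝 x] fun y => fderiv ℝ E y (Pi.single j 1) := by
    filter_upwards [hC.isOpen.mem_nhds hx] with y hy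
    rw [← hC.partial_length y hy j i h.symm]
    simp only [hE, edgeVal_comm _ j i, partialDeriv]
  have e : ∀ u v : V → ℝ, fderiv ℝ (fun y => fderiv ℝ E y u) x v =
      fderiv ℝ (fderiv ℝ E) x v u := by
    intro u v
    rw [fderiv_clm_apply hd (differentiableAt_const u)]
    simp
  rw [q, q, partialDeriv, partialDeriv, h₁.fderiv_eq, h₂.fderiv_eq, e, e]
  exact hsymm _ _

/-- Only f_i and f_j matter, and differentiating ℓ_ij = d_ij + d_ji in f_i gives ∂d_ij/∂f_i = d_ij -
q_ij by the symmetry of q. -/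
theorem fderiv_dirVal (hC : IsConformalStructure T U C) {i j : V} (h : (skeleton T).Adj i j)
    (hx : x ∈ U) (a : V → ℝ) :
    fderiv ℝ (fun y => dirVal (C y) i j) x a = dirVal (C x) i j * a i + q C x i j * (a j - a i) := by
  rw [fderiv_apply_eq_sum_partialDeriv, Fintype.sum_eq_add i j h.1 fun k hk => by
    rw [hC.partial_dir x hx i j h k hk.1 hk.2, mul_zero]]
  have h₁ := hC.partialDeriv_add h hx
  have h₂ := hC.q_comm h hx
  have h₃ : partialDeriv (fun y => dirVal (C y) j i) i x = q C x j i := rfl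
  have h₄ : partialDeriv (fun y => dirVal (C y) i j) j x = q C x i j := rfl
  rw [h₄]
  rw [h₃, ← h₂] at h₁
  linear_combination a i * h₁

variable {f : ℝ → V → ℝ} {a : V → ℝ} {t : ℝ}

theorem hasDerivAt_comp (hC : IsConformalStructure T U C) (hU : f t ∈ U)
    (hf : HasDerivAt f a t) :
    HasDerivAt (fun s => C (f s)) (fderiv ℝ C (f t) a) t :=
  HasFDerivAt.comp_hasDerivAt (l := C) t (hC.differentiableAt hU).hasFDerivAt hf

theorem dirVal_fderiv (hC : IsConformalStructure T U C) {i j : V} (h : (skeleton T).Adj i j)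
    (hx : x ∈ U) (a : V → ℝ) :
    dirVal (fderiv ℝ C x a) i j = dirVal (C x) i j * a i + q C x i j * (a j - a i) := by
  have hl : HasDerivAt (fun s : ℝ => x + s • a) a 0 := by
    simpa using ((hasDerivAt_id (0 : ℝ)).smul_const a).const_add x
  have h₁ := hasDerivAt_dirVal (hC.hasDerivAt_comp (f := fun s : ℝ => x + s • a) (t := 0)
    (by simpa using hx) hl) i j
  have h₂ : HasDerivAt (fun s : ℝ => dirVal (C (x + s • a)) i j) _ 0 :=
    HasFDerivAt.comp_hasDerivAt (l := fun y => dirVal (C y) i j) (f := fun s : ℝ => x + s • a)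
    (0 : ℝ) (by
      simpa using ((hC.contDiffAt_dirVal hx i j).differentiableAt (by simp)).hasFDerivAt) hl
  have := h₁.unique h₂
  rw [← hC.fderiv_dirVal h hx]
  simpa using this

theorem edgeVal_length_fderiv (hC : IsConformalStructure T U C) {i j : V}
    (h : (skeleton T).Adj i j) (hx : x ∈ U) (a : V → ℝ) :
    edgeVal (length (fderiv ℝ C x a)) i j =
      dirVal (C x) i j * a i + dirVal (C x) j i * a j := by
  rw [edgeVal_length _ h, hC.dirVal_fderiv h hx, hC.dirVal_fderiv h.symm hx, hC.q_comm h hx]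
  ring

/-- The first variation along a curve. -/
theorem hasDerivAt_EHRalong (hC : IsConformalStructure T U C) (hU : f t ∈ U)
    (hf : HasDerivAt f a t) :
    HasDerivAt (EHRalong C f) (∑ i, scalarCurvature (C (f t)) i * a i) t := by
  have hpf := (hC.mapsTo hU).1
  refine (hasDerivAt_EHR (hasDerivAt_length (hC.hasDerivAt_comp hU hf)) hpf).congr_deriv ?_
  have e₁ : ∑ i, ∑ j ∈ nbrs T i, deficit (length (C (f t))) i j *
      edgeVal (length (fderiv ℝ C (f t) a)) i j =
      ∑ i, ∑ j ∈ nbrs T i, (deficit (length (C (f t))) i j * dirVal (C (f t)) i j * a i +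
        deficit (length (C (f t))) i j * dirVal (C (f t)) j i * a j) :=
    Finset.sum_congr rfl fun i _ => Finset.sum_congr rfl fun j hj => by
      rw [hC.edgeVal_length_fderiv (mem_nbrs.1 hj) hU]; ring
  -- Reversing edges turns the d_ji a_j half into the d_ij a_i half because the deficit is
  -- symmetric; this cancels the 1/2 in `EHR`.
  have e₂ := sum_nbrs_comm (T := T) fun i j =>
    deficit (length (C (f t))) i j * dirVal (C (f t)) j i * a j
  simp only [hpf.deficit_comm] at e₂
  rw [e₁]
  simp only [Finset.sum_add_distrib]
  rw [e₂]
  simp only [scalarCurvature, Finset.sum_mul]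
  ring

theorem hasDerivAt_scalarCurvature (hC : IsConformalStructure T U C) (hU : f t ∈ U)
    (hf : HasDerivAt f a t) (i : V) :
    HasDerivAt (fun s => scalarCurvature (C (f s)) i)
      (∑ j ∈ nbrs T i, ((-(1 / 2) * ∑ p ∈ link T i j,
        dihedralDeriv (length (C (f t))) (length (fderiv ℝ C (f t) a)) i j p.1 p.2) *
          dirVal (C (f t)) i j + deficit (length (C (f t))) i j *
          (dirVal (C (f t)) i j * a i + q C (f t) i j * (a j - a i)))) t := by
  have hD := hC.hasDerivAt_comp hU hf
  refine HasDerivAt.fun_sum fun j hj => ?_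
  refine ((hasDerivAt_deficit (hasDerivAt_length hD) (hC.mapsTo hU).1 i j).mul
    (hasDerivAt_dirVal hD i j)).congr_deriv ?_
  rw [hC.dirVal_fderiv (mem_nbrs.1 hj) hU]

/-- The derivative of the scalar curvatures, paired with the conformal variation. -/
theorem sum_deriv_scalarCurvature (hC : IsConformalStructure T U C) (hx : x ∈ U) (a : V → ℝ) :
    ∑ i, (∑ j ∈ nbrs T i, ((-(1 / 2) * ∑ p ∈ link T i j,
        dihedralDeriv (length (C x)) (length (fderiv ℝ C x a)) i j p.1 p.2) *
          dirVal (C x) i j + deficit (length (C x)) i j *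
          (dirVal (C x) i j * a i + q C x i j * (a j - a i)))) * a i =
      ∑ i, ∑ j ∈ nbrs T i, (dualLength (C x) i j / edgeVal (length (C x)) i j -
          q C x i j / (2 * edgeVal (length (C x)) i j) * edgeCurvature (length (C x)) i j) *
            (a j - a i) ^ 2 +
        ∑ i, scalarCurvature (C x) i * a i ^ 2 := by
  have hd := hC.mapsTo hx
  have hpf := hd.1
  have key := tetSum_dihedralDeriv_mul_dirVal hd (length (fderiv ℝ C x a)) a fun i j h =>
    hC.edgeVal_length_fderiv h hx a
  rw [← sum_nbrs_link, ← sum_nbrs_link] at key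
  -- The coefficient deficit · q is symmetric in i and j, so averaging with the reversed edge
  -- replaces (a_j - a_i) a_i by -(a_j - a_i)²/2; the factor ℓ_ij in K_ij cancels the one in the
  -- denominator.
  have e₁ : ∑ i, ∑ j ∈ nbrs T i, deficit (length (C x)) i j * q C x i j * (a j - a i) * a i =
      ∑ i, ∑ j ∈ nbrs T i, -(q C x i j / (2 * edgeVal (length (C x)) i j) *
        edgeCurvature (length (C x)) i j * (a j - a i) ^ 2) := by
    have s := sum_nbrs_comm (T := T) fun i j =>
      deficit (length (C x)) i j * q C x i j * (a j - a i) * a i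
    have s' : ∑ i, ∑ j ∈ nbrs T i, (deficit (length (C x)) i j * q C x i j * (a j - a i) * a i +
        deficit (length (C x)) j i * q C x j i * (a i - a j) * a j) =
        ∑ i, ∑ j ∈ nbrs T i, 2 * -(q C x i j / (2 * edgeVal (length (C x)) i j) *
          edgeCurvature (length (C x)) i j * (a j - a i) ^ 2) :=
      Finset.sum_congr rfl fun i _ => Finset.sum_congr rfl fun j hj => by
        have := hpf.edgeVal_pos (mem_nbrs.1 hj)
        rw [hpf.deficit_comm i j, ← hC.q_comm (mem_nbrs.1 hj) hx, edgeCurvature]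
        field_simp
        ring
    simp only [Finset.sum_add_distrib, ← Finset.mul_sum] at s'
    linarith
  -- The link lists every tetrahedron twice, whence the 2.
  have e₂ : ∑ i, ∑ j ∈ nbrs T i, ∑ p ∈ link T i j, dualArea (C x) i j p.1 p.2 /
      edgeVal (length (C x)) i j * (a j - a i) ^ 2 =
      2 * ∑ i, ∑ j ∈ nbrs T i, dualLength (C x) i j / edgeVal (length (C x)) i j *
        (a j - a i) ^ 2 := by
    simp only [dualLength, ← Finset.sum_div, ← Finset.sum_mul, Finset.mul_sum]
    refine Finset.sum_congr rfl fun i _ => Finset.sum_congr rfl fun j _ => ?_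
    rw [← Finset.mul_sum]
    ring
  rw [e₂] at key
  have e₃ : ∑ i, (∑ j ∈ nbrs T i, ((-(1 / 2) * ∑ p ∈ link T i j,
        dihedralDeriv (length (C x)) (length (fderiv ℝ C x a)) i j p.1 p.2) *
          dirVal (C x) i j + deficit (length (C x)) i j *
          (dirVal (C x) i j * a i + q C x i j * (a j - a i)))) * a i =
      -(1 / 2) * ∑ i, ∑ j ∈ nbrs T i, ∑ p ∈ link T i j,
        dihedralDeriv (length (C x)) (length (fderiv ℝ C x a)) i j p.1 p.2 *
          dirVal (C x) i j * a i +
      ∑ i, ∑ j ∈ nbrs T i, deficit (length (C x)) i j * q C x i j * (a j - a i) * a i +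
      ∑ i, scalarCurvature (C x) i * a i ^ 2 := by
    simp only [scalarCurvature, Finset.mul_sum, Finset.sum_mul, ← Finset.sum_add_distrib]
    refine Finset.sum_congr rfl fun i _ => Finset.sum_congr rfl fun j _ => ?_
    rw [add_mul, Finset.sum_mul, add_assoc]
    congr 1
    · exact Finset.sum_congr rfl fun p _ => by ring
    · ring
  rw [e₃, key, e₁]
  simp only [sub_mul, Finset.sum_sub_distrib, Finset.sum_neg_distrib]
  ring

/-- A point of a conformal structure is critical if and only if all scalar curvatures vanish. -/
theorem hasFDerivAt_zero_iff (hC : IsConformalStructure T U C) (hx : x ∈ U) :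
    HasFDerivAt (fun y => EHR (length (C y))) (0 : (V → ℝ) →L[ℝ] ℝ) x ↔
      ∀ i, scalarCurvature (C x) i = 0 := by
  have line : ∀ a : V → ℝ, HasDerivAt (fun s : ℝ => x + s • a) a 0 := fun a => by
    simpa using ((hasDerivAt_id (0 : ℝ)).smul_const a).const_add x
  have hdiff : DifferentiableAt ℝ (fun y => EHR (length (C y))) x :=
    DifferentiableAt.fun_comp' x (differentiableAt_EHR (hC.mapsTo hx).1)
      ((differentiable_length _).fun_comp' x (hC.differentiableAt hx))
  have hfd : ∀ a, fderiv ℝ (fun y => EHR (length (C y))) x a =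
      ∑ i, scalarCurvature (C x) i * a i := by
    intro a
    have h₁ : HasDerivAt (fun s : ℝ => EHR (length (C (x + s • a)))) _ 0 :=
      HasFDerivAt.comp_hasDerivAt (l := fun y => EHR (length (C y)))
        (f := fun s : ℝ => x + s • a) (0 : ℝ) (by simpa using hdiff.hasFDerivAt) (line a)
    have h₂ := hC.hasDerivAt_EHRalong (f := fun s : ℝ => x + s • a) (t := 0) (by simpa using hx)
      (line a)
    simpa using h₁.unique h₂
  constructor
  · intro h i
    have := hfd (Pi.single i 1)
    rw [h.fderiv, Fintype.sum_eq_single i fun j hj => by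
      rw [Pi.single_eq_of_ne hj, mul_zero]] at this
    simpa using this.symm
  · intro h
    have e : fderiv ℝ (fun y => EHR (length (C y))) x = 0 := by
      ext1 a
      rw [hfd]
      simp [h]
    rw [← e]
    exact hdiff.hasFDerivAt

end IsConformalStructure

/-! ### First and second variation along a curve, and the main theorem. -/

namespace IsConformalVariation

variable {d₀ : DirEdge T → ℝ} {ε : ℝ} {f : ℝ → V → ℝ} {U : Set (V → ℝ)}
  {C : (V → ℝ) → (DirEdge T → ℝ)} {t : ℝ}

theorem contDiffAt (hf : IsConformalVariation d₀ ε f U C) (ht : t ∈ Set.Ioo (-ε) ε) :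
    ContDiffAt ℝ ∞ f t :=
  hf.smooth.contDiffAt (isOpen_Ioo.mem_nhds ht)

theorem zero_mem (hf : IsConformalVariation d₀ ε f U C) : (0 : ℝ) ∈ Set.Ioo (-ε) ε :=
  ⟨neg_lt_zero.2 hf.pos, hf.pos⟩

theorem hasDerivAt (hf : IsConformalVariation d₀ ε f U C) (ht : t ∈ Set.Ioo (-ε) ε) :
    HasDerivAt f (deriv f t) t :=
  ((hf.contDiffAt ht).differentiableAt (by simp)).hasDerivAt

theorem hasDerivAt_deriv (hf : IsConformalVariation d₀ ε f U C) (ht : t ∈ Set.Ioo (-ε) ε) :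
    HasDerivAt (deriv f) (deriv (deriv f) t) t := by
  have h : ContDiffOn ℝ 1 (deriv f) (Set.Ioo (-ε) ε) :=
    (contDiffOn_infty.1 hf.smooth 2).deriv_of_isOpen isOpen_Ioo (by norm_num)
  exact ((h.contDiffAt (isOpen_Ioo.mem_nhds ht)).differentiableAt (by simp)).hasDerivAt

theorem hasDerivAt_EHRalong (hf : IsConformalVariation d₀ ε f U C) (ht : t ∈ Set.Ioo (-ε) ε) :
    HasDerivAt (EHRalong C f) (∑ i, scalarCurvature (C (f t)) i * deriv f t i) t :=
  hf.conformal.hasDerivAt_EHRalong (hf.mapsTo ht) (hf.hasDerivAt ht)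

/-- The second variation. -/
theorem hasDerivAt_deriv_EHRalong (hf : IsConformalVariation d₀ ε f U C)
    (ht : t ∈ Set.Ioo (-ε) ε) :
    HasDerivAt (deriv (EHRalong C f)) (gradientTerm C f t +
      ∑ i, scalarCurvature (C (f t)) i * (deriv f t i ^ 2 + deriv (deriv f) t i)) t := by
  have hev : deriv (EHRalong C f) =ᶠ[𝓝 t]
      fun s => ∑ i, scalarCurvature (C (f s)) i * deriv f s i := by
    filter_upwards [isOpen_Ioo.mem_nhds ht] with s hs
    exact (hf.hasDerivAt_EHRalong hs).deriv
  have := HasDerivAt.fun_sum fun i (_ : i ∈ Finset.univ) =>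
    (hf.conformal.hasDerivAt_scalarCurvature (hf.mapsTo ht) (hf.hasDerivAt ht) i).mul
      (hasDerivAt_pi.1 (hf.hasDerivAt_deriv ht) i)
  refine (this.congr_of_eventuallyEq hev).congr_deriv ?_
  rw [Finset.sum_add_distrib, hf.conformal.sum_deriv_scalarCurvature (hf.mapsTo ht), gradientTerm]
  simp only [mul_add, Finset.sum_add_distrib]
  ring

/-- Every direction is the velocity of a conformal variation with the same extension. -/
theorem exists_line (hf : IsConformalVariation d₀ ε f U C) (a : V → ℝ) :
    ∃ δ, IsConformalVariation d₀ δ (fun s => f 0 + s • a) U C := by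
  have hc : Continuous fun s : ℝ => f 0 + s • a := by fun_prop
  have hmem : (fun s : ℝ => f 0 + s • a) ⁻¹' U ∈ 𝓝 (0 : ℝ) :=
    (hf.conformal.isOpen.preimage hc).mem_nhds (by simpa using hf.mapsTo hf.zero_mem)
  obtain ⟨δ, hδ, hsub⟩ := Metric.mem_nhds_iff.1 hmem
  refine ⟨δ, hδ, ?_, hf.conformal, fun s hs => hsub ?_, by simpa using hf.base⟩
  · exact ContDiff.contDiffOn (by fun_prop)
  · rw [Real.ball_eq_Ioo]
    simpa using hs

/-- At t = 0 the first variation sees an extension only through its value d₀. The converse needs one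
conformal structure through d₀, supplied by the given variation, and coordinate lines in it. -/
theorem forall_hasDerivAt_zero_iff (hf : IsConformalVariation d₀ ε f U C) :
    (∀ (δ : ℝ) (g : ℝ → V → ℝ) (W : Set (V → ℝ)) (D : (V → ℝ) → (DirEdge T → ℝ)),
        IsConformalVariation d₀ δ g W D → HasDerivAt (EHRalong D g) 0 0) ↔
      ∀ i, scalarCurvature d₀ i = 0 := by
  constructor
  · intro h i
    obtain ⟨δ, hg⟩ := hf.exists_line (Pi.single i 1)
    have h₁ := (h _ _ _ _ hg).unique (hg.hasDerivAt_EHRalong hg.zero_mem)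
    have hl : HasDerivAt (fun s : ℝ => f 0 + s • (Pi.single i 1 : V → ℝ)) (Pi.single i 1) 0 := by
      simpa using ((hasDerivAt_id (0 : ℝ)).smul_const (Pi.single i 1 : V → ℝ)).const_add (f 0)
    rw [hg.base, hl.deriv, Fintype.sum_eq_single i fun j hj => by
      rw [Pi.single_eq_of_ne hj, mul_zero]] at h₁
    simpa using h₁.symm
  · intro h δ g W D hg
    refine (hg.hasDerivAt_EHRalong hg.zero_mem).congr_deriv ?_
    rw [hg.base]
    simp [h]

end IsConformalVariation

end Conformal

end PiecewiseFlat

end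

theorem mainTheorem5 {M V : Type*} [TopologicalSpace M] [T2Space M] [CompactSpace M]
    [ChartedSpace (EuclideanSpace ℝ (Fin 3)) M] [Fintype V] [DecidableEq V]
    (T : PiecewiseFlat.Triangulation V M)
    (d₀ : PiecewiseFlat.DirEdge T.complex → ℝ) (ε : ℝ) (f : ℝ → V → ℝ)
    (U : Set (V → ℝ)) (C : (V → ℝ) → (PiecewiseFlat.DirEdge T.complex → ℝ))
    (hf : PiecewiseFlat.IsConformalVariation d₀ ε f U C) :
    -- symmetry of `q`
    (∀ x ∈ U, ∀ i j, (PiecewiseFlat.skeleton T.complex).Adj i j →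
      PiecewiseFlat.partialDeriv (fun y => PiecewiseFlat.dirVal (C y) i j) j x =
        PiecewiseFlat.partialDeriv (fun y => PiecewiseFlat.dirVal (C y) j i) i x) ∧
    -- first variation
    (∀ t ∈ Set.Ioo (-ε) ε,
      HasDerivAt (PiecewiseFlat.EHRalong C f)
        (∑ i, PiecewiseFlat.scalarCurvature (C (f t)) i * deriv f t i) t) ∧
    -- second variation
    (∀ t ∈ Set.Ioo (-ε) ε,
      HasDerivAt (deriv (PiecewiseFlat.EHRalong C f))
        (PiecewiseFlat.gradientTerm C f t +
          ∑ i, PiecewiseFlat.scalarCurvature (C (f t)) i *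
            (deriv f t i ^ 2 + deriv (deriv f) t i)) t) ∧
    -- critical points, within the conformal structure and for all conformal variations of `d₀`
    (HasFDerivAt (fun x => PiecewiseFlat.EHR (PiecewiseFlat.length (C x)))
        (0 : (V → ℝ) →L[ℝ] ℝ) (f 0) ↔
      ∀ i, PiecewiseFlat.scalarCurvature d₀ i = 0) ∧
    ((∀ (δ : ℝ) (g : ℝ → V → ℝ) (W : Set (V → ℝ))
        (D : (V → ℝ) → (PiecewiseFlat.DirEdge T.complex → ℝ)),
        PiecewiseFlat.IsConformalVariation d₀ δ g W D →
          HasDerivAt (PiecewiseFlat.EHRalong D g) 0 0) ↔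
      ∀ i, PiecewiseFlat.scalarCurvature d₀ i = 0) ∧
    -- second variation at a critical metric
    ((∀ i, PiecewiseFlat.scalarCurvature d₀ i = 0) →
      HasDerivAt (deriv (PiecewiseFlat.EHRalong C f)) (PiecewiseFlat.gradientTerm C f 0) 0) ∧
    -- critical points of the functional on all edge lengths
    (HasFDerivAt (PiecewiseFlat.EHR (T := T.complex))
        (0 : (PiecewiseFlat.Edge T.complex → ℝ) →L[ℝ] ℝ) (PiecewiseFlat.length d₀) ↔
      ∀ i j, (PiecewiseFlat.skeleton T.complex).Adj i j →
        PiecewiseFlat.edgeCurvature (PiecewiseFlat.length d₀) i j = 0) ∧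
    -- second variation at a Ricci flat metric
    ((∀ i j, (PiecewiseFlat.skeleton T.complex).Adj i j →
        PiecewiseFlat.edgeCurvature (PiecewiseFlat.length d₀) i j = 0) →
      HasDerivAt (deriv (PiecewiseFlat.EHRalong C f))
        (∑ i, ∑ j ∈ PiecewiseFlat.nbrs T.complex i,
          PiecewiseFlat.dualLength d₀ i j /
              PiecewiseFlat.edgeVal (PiecewiseFlat.length d₀) i j *
            (deriv f 0 j - deriv f 0 i) ^ 2) 0) := by
  have h₀ := hf.zero_mem
  have hU := hf.mapsTo h₀
  have hb := hf.base
  have hmet : d₀ ∈ PiecewiseFlat.met T.complex := hb ▸ hf.conformal.mapsTo hU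
  have hsecond : (∀ i, PiecewiseFlat.scalarCurvature d₀ i = 0) →
      HasDerivAt (deriv (PiecewiseFlat.EHRalong C f)) (PiecewiseFlat.gradientTerm C f 0) 0 := by
    intro h
    refine (hf.hasDerivAt_deriv_EHRalong h₀).congr_deriv ?_
    rw [hb]
    simp [h]
  refine ⟨fun x hx i j h => hf.conformal.q_comm h hx, fun t ht => hf.hasDerivAt_EHRalong ht,
    fun t ht => hf.hasDerivAt_deriv_EHRalong ht, ?_, hf.forall_hasDerivAt_zero_iff, hsecond,
    PiecewiseFlat.hasFDerivAt_EHR_zero_iff hmet.1, fun h => ?_⟩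
  · rw [hf.conformal.hasFDerivAt_zero_iff hU, hb]
  -- Lengths are positive, so Ricci flatness makes all deficits vanish, hence every K_i as well; the
  -- q-terms drop out because they carry the factor K_ij.
  · refine (hsecond fun i => Finset.sum_eq_zero fun j hj => ?_).congr_deriv ?_
    · have hij := PiecewiseFlat.mem_nbrs.1 hj
      have := h i j hij
      rw [PiecewiseFlat.edgeCurvature, mul_eq_zero,
        or_iff_left (hmet.1.edgeVal_pos hij).ne'] at this
      rw [this, zero_mul]
    · rw [PiecewiseFlat.gradientTerm, hb]
      refine Finset.sum_congr rfl fun i _ => Finset.sum_congr rfl fun j hj => ?_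
      rw [h i j (PiecewiseFlat.mem_nbrs.1 hj), mul_zero, sub_zero]
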